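/- For a real number $r\ge 0$ let $\mathrm T(r)$ be the space of real trigonometric polynomials $t(x)=A+\sum_{k=1}^{\lfloor r\rfloor}(a_k\cos kx+b_k\sin kx)$ with $A,a_k,b_k\in\mathbb R$, and put $\|g\|_1=\int_0^{2\pi}|g(x)|\,dx$ and $\|g\|_\infty=\operatorname{ess\,sup}_{[0,2\pi]}|g|$. There is an absolute constant $c>0$ such that the following holds. Let $\varepsilon\in(0,1)$ and $\lambda>1$ be real numbers, and let $\{n_k\}_{k=1}^\infty$ be a sequence of positive integers with $n_{k+1}/n_k\ge\lambda$ for all $k\ge 1$. Put $$\gamma=\min\left(\frac{\lambda-1}{2(1+\varepsilon)},\frac{1}{1+\varepsilon}\right).$$ Let $l$ and $m$ be positive integers with $m\ge l+2$, let $p_k,q_k\in\mathrm T(\gamma n_l)$ for $k=l,\dots,m$, and let $$f(x)=\sum_{k=l}^m\bigl(p_k(x)\cos n_kx+q_k(x)\sin n_kx\bigr).$$ Then $$\|f\|_\infty\ \ge\ \frac{c}{\lceil \ln 7/\ln\lambda\rceil^{2}\,\ln^{2}(1+1/\varepsilon)}\sum_{k=l}^m\bigl(\|p_k\|_1+\|q_k\|_1\bigr).$$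 -/

import Mathlib

open Real MeasureTheory
open scoped ENNReal

/-- The space `T(r)`, `r ≥ 0`, of real trigonometric polynomials
`A + ∑_{k=1}^{[r]} (a_k cos kx + b_k sin kx)`, as functions on `ℝ`. -/
def TrigPoly (r : ℝ) : Set (ℝ → ℝ) :=
  {t | ∃ (A : ℝ) (a b : ℕ → ℝ), ∀ x : ℝ,
    t x = A + ∑ k ∈ Finset.Icc 1 ⌊r⌋₊, (a k * Real.cos (k * x) + b k * Real.sin (k * x))}

/-- The norm `‖f‖_p` on `(0, 2π)` with respect to (non-normalized) Lebesgue measure, with values in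
`[0, ∞]`; for `p = 1` it is `∫_0^{2π} |f|`, for `p = ∞` the essential supremum of `|f|`. -/
noncomputable def normLp (p : ℝ≥0∞) (f : ℝ → ℝ) : ℝ≥0∞ :=
  eLpNorm f p (volume.restrict (Set.Icc 0 (2 * Real.pi)))

/-! The proof is by duality: `f` is integrated against a nonnegative Riesz product `G = ∏ (1 + t
h_i)`. Here `h_i = u_i cos N_i x` or `u_i sin N_i x`, where `|u_i| ≤ 1` and `u_i` nearly norms the
coefficient of the same mode in `f`. The blocks of `f` have mean zero, so the order-0 part of `G`
contributes nothing. The linear part sees only matching frequencies and yields `t` times a multiple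
of the coefficients' `L¹` norms. The order-≥2 part costs `O(t²)` times the `L¹` norms of all
coefficients. Since `∫ G = O(1)`, a small `t` gives the inequality.

Two estimates carry this. `LacunaryFactors.norm_integral_mul_rieszTail_le` bounds both `∫ G` and the
order-≥2 part independently of the number of factors. The `u_i` have degree up to the lowest
frequency, so expanding the product gives no unique representation of frequencies. Instead the top
factor is peeled off repeatedly, and at most one of the three resulting spectral bands contains
frequency 0. `exists_band_norming` builds `u_i` by smoothing the sign of the coefficient with a de
la Vallée-Poussin kernel, whose `L¹` norm is the source of `ln (1 + 1/ε)`.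

The Riesz product needs ratio 7, so indices are split into `s = ⌈ln 7 / ln λ⌉` residue classes. The
heaviest class and the better of cosine and sine are tested. The diagonal gain is `t / (s L)`
against a loss `t²`, with `L` the kernel bound; optimising in `t` gives `1 / (s L)²`. -/

/-! ### Characters and spectral bands -/

/-- The character `x ↦ exp (i k x)` of frequency `k`. -/
noncomputable def expMode (k : ℤ) : ℝ → ℂ := fun x => Complex.exp (k * x * Complex.I)

/-- The complex trigonometric polynomials with all frequencies in `[a, b]`. -/
def band (a b : ℤ) : Submodule ℂ (ℝ → ℂ) := Submodule.span ℂ (expMode '' Set.Icc a b)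

/-- Lebesgue measure on a period. -/
noncomputable abbrev periodMeasure : Measure ℝ := volume.restrict (Set.Icc 0 (2 * π))

theorem expMode_mul (j k : ℤ) : expMode j * expMode k = expMode (j + k) := by
  funext x
  simp only [expMode, Pi.mul_apply, ← Complex.exp_add]
  congr 1; push_cast; ring

theorem expMode_zero : expMode 0 = 1 := by
  funext x; simp [expMode]

theorem expMode_sub (k : ℤ) (x y : ℝ) : expMode k (x - y) = expMode k x * expMode (-k) y := by
  simp only [expMode, ← Complex.exp_add]
  congr 1; push_cast; ring

theorem norm_expMode (k : ℤ) (x : ℝ) : ‖expMode k x‖ = 1 := by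
  have := Complex.norm_exp_ofReal_mul_I (k * x)
  simpa [expMode] using this

theorem continuous_expMode (k : ℤ) : Continuous (expMode k) := by
  unfold expMode; fun_prop

theorem expMode_mem_band {a b k : ℤ} (h1 : a ≤ k) (h2 : k ≤ b) : expMode k ∈ band a b :=
  Submodule.subset_span ⟨k, ⟨h1, h2⟩, rfl⟩

theorem one_mem_band {a b : ℤ} (h1 : a ≤ 0) (h2 : 0 ≤ b) : (1 : ℝ → ℂ) ∈ band a b := by
  rw [← expMode_zero]; exact expMode_mem_band h1 h2

theorem band_mono {a b a' b' : ℤ} (ha : a' ≤ a) (hb : b ≤ b') : band a b ≤ band a' b' :=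
  Submodule.span_mono (Set.image_mono (Set.Icc_subset_Icc ha hb))

theorem mul_mem_band {a b a' b' : ℤ} {f g : ℝ → ℂ} (hf : f ∈ band a b) (hg : g ∈ band a' b') :
    f * g ∈ band (a + a') (b + b') := by
  have h := Submodule.mul_mem_mul hf hg
  rw [band, band, Submodule.span_mul_span] at h
  refine Submodule.span_mono ?_ h
  rintro _ ⟨_, ⟨j, hj, rfl⟩, _, ⟨k, hk, rfl⟩, rfl⟩
  exact ⟨j + k, ⟨add_le_add hj.1 hk.1, add_le_add hj.2 hk.2⟩, (expMode_mul j k).symm⟩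

theorem continuous_of_mem_band {a b : ℤ} {f : ℝ → ℂ} (hf : f ∈ band a b) : Continuous f := by
  induction hf using Submodule.span_induction with
  | mem x h => obtain ⟨k, -, rfl⟩ := h; exact continuous_expMode k
  | zero => exact continuous_const
  | add f g _ _ hf hg => exact hf.add hg
  | smul c f _ hf => exact hf.const_smul c

theorem integrable_period {E : Type*} [NormedAddCommGroup E] {f : ℝ → E} (hf : Continuous f) :
    Integrable f periodMeasure :=
  (hf.continuousOn).integrableOn_compact isCompact_Icc

theorem integral_period {E : Type*} [NormedAddCommGroup E] [NormedSpace ℝ E] (f : ℝ → E) :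
    ∫ x, f x ∂periodMeasure = ∫ x in (0 : ℝ)..(2 * π), f x := by
  rw [intervalIntegral.integral_of_le (by positivity), integral_Icc_eq_integral_Ioc]

theorem integral_expMode (k : ℤ) :
    ∫ x, expMode k x ∂periodMeasure = if k = 0 then (2 * π : ℂ) else 0 := by
  split_ifs with h
  · subst h
    simp [expMode_zero, Measure.real, Real.pi_pos.le]
  · rw [integral_period]
    have hc : (k : ℂ) * Complex.I ≠ 0 := by simp [h]
    have : ∀ x : ℝ, expMode k x = Complex.exp ((k * Complex.I) * x) := by
      intro x; simp only [expMode]; congr 1; ring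
    simp only [this]
    rw [integral_exp_mul_complex hc]
    have h2 : Complex.exp (k * Complex.I * ((2 * π : ℝ) : ℂ)) = 1 := by
      rw [Complex.exp_eq_one_iff]; exact ⟨k, by push_cast; ring⟩
    rw [h2]; simp

theorem integral_eq_zero_of_mem_band {a b : ℤ} {f : ℝ → ℂ} (hf : f ∈ band a b)
    (h : 0 < a ∨ b < 0) : ∫ x, f x ∂periodMeasure = 0 := by
  induction hf using Submodule.span_induction with
  | mem x hx =>
    obtain ⟨k, hk, rfl⟩ := hx
    rw [integral_expMode, if_neg]
    have := hk.1; have := hk.2; omega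
  | zero => simp
  | add f g hf hg ihf ihg =>
    have := integral_add (integrable_period (continuous_of_mem_band hf))
      (integrable_period (continuous_of_mem_band hg))
    simp only [Pi.add_apply]
    rw [this, ihf, ihg, add_zero]
  | smul c f _ ih => simp only [Pi.smul_apply]; rw [integral_smul, ih, smul_zero]

theorem cos_mul_eq_expMode (k : ℕ) (x : ℝ) :
    ((Real.cos (k * x) : ℝ) : ℂ) = (1 / 2) * expMode k x + (1 / 2) * expMode (-k) x := by
  rw [Complex.ofReal_cos, Complex.cos, expMode, expMode]; push_cast; ring_nf

theorem sin_mul_eq_expMode (k : ℕ) (x : ℝ) :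
    ((Real.sin (k * x) : ℝ) : ℂ)
      = (-Complex.I / 2) * expMode k x + (Complex.I / 2) * expMode (-k) x := by
  rw [Complex.ofReal_sin, Complex.sin, expMode, expMode]; push_cast; ring_nf

theorem cos_mem_band (k : ℕ) : (fun x : ℝ => ((Real.cos (k * x) : ℝ) : ℂ)) ∈ band (-k) k := by
  have : (fun x : ℝ => ((Real.cos (k * x) : ℝ) : ℂ))
      = (1 / 2 : ℂ) • expMode k + (1 / 2 : ℂ) • expMode (-k) := by
    funext x; simpa using cos_mul_eq_expMode k x
  rw [this]
  exact add_mem (Submodule.smul_mem _ _ (expMode_mem_band (by omega) le_rfl))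
    (Submodule.smul_mem _ _ (expMode_mem_band le_rfl (by omega)))

theorem sin_mem_band (k : ℕ) : (fun x : ℝ => ((Real.sin (k * x) : ℝ) : ℂ)) ∈ band (-k) k := by
  have : (fun x : ℝ => ((Real.sin (k * x) : ℝ) : ℂ))
      = (-Complex.I / 2 : ℂ) • expMode k + (Complex.I / 2 : ℂ) • expMode (-k) := by
    funext x; simpa using sin_mul_eq_expMode k x
  rw [this]
  exact add_mem (Submodule.smul_mem _ _ (expMode_mem_band (by omega) le_rfl))
    (Submodule.smul_mem _ _ (expMode_mem_band le_rfl (by omega)))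

theorem ofReal_mem_band_of_mem_trigPoly {r : ℝ} {p : ℝ → ℝ} (hp : p ∈ TrigPoly r) :
    (fun x => (p x : ℂ)) ∈ band (-⌊r⌋₊) ⌊r⌋₊ := by
  obtain ⟨A, a, b, h⟩ := hp
  have : (fun x => (p x : ℂ)) = (A : ℂ) • (1 : ℝ → ℂ) + ∑ k ∈ Finset.Icc 1 ⌊r⌋₊,
      ((a k : ℂ) • (fun x : ℝ => ((Real.cos (k * x) : ℝ) : ℂ))
        + (b k : ℂ) • (fun x : ℝ => ((Real.sin (k * x) : ℝ) : ℂ))) := by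
    funext x; rw [h x]; simp
  rw [this]
  refine add_mem (Submodule.smul_mem _ _ (one_mem_band (by omega) (by omega)))
    (Submodule.sum_mem _ fun k hk => ?_)
  have hk := (Finset.mem_Icc.1 hk).2
  exact add_mem (Submodule.smul_mem _ _ (band_mono (by omega) (by omega) (cos_mem_band k)))
    (Submodule.smul_mem _ _ (band_mono (by omega) (by omega) (sin_mem_band k)))

/-! ### Riesz products and their tails -/

/-- `rieszTail t h K j` is the sum of the terms of order at least `j` in the expansion of the
Riesz product `∏ i < K, (1 + t * h i)`. -/
noncomputable def rieszTail (t : ℝ) (h : ℕ → ℝ → ℂ) : ℕ → ℕ → ℝ → ℂ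
  | 0, j => if j = 0 then 1 else 0
  | K + 1, j => rieszTail t h K j + (t : ℂ) • (h K * rieszTail t h K (j - 1))

theorem rieszTail_zero_eq_prod (t : ℝ) (h : ℕ → ℝ → ℂ) (K : ℕ) (x : ℝ) :
    rieszTail t h K 0 x = ∏ i ∈ Finset.range K, (1 + t * h i x) := by
  induction K with
  | zero => simp [rieszTail]
  | succ K ih =>
    rw [Finset.prod_range_succ, ← ih]
    simp [rieszTail]; ring

theorem rieszTail_zero_eq_one_add (t : ℝ) (h : ℕ → ℝ → ℂ) (K : ℕ) :
    rieszTail t h K 0 = 1 + rieszTail t h K 1 := by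
  induction K with
  | zero => simp [rieszTail]
  | succ K ih =>
    simp only [rieszTail, Nat.zero_sub, Nat.sub_self]
    nth_rewrite 1 [ih]
    ring

theorem rieszTail_one_eq_sum_add (t : ℝ) (h : ℕ → ℝ → ℂ) (K : ℕ) :
    rieszTail t h K 1 = ∑ i ∈ Finset.range K, (t : ℂ) • h i + rieszTail t h K 2 := by
  induction K with
  | zero => simp [rieszTail]
  | succ K ih =>
    rw [Finset.sum_range_succ]
    simp only [rieszTail, Nat.sub_self, show 2 - 1 = 1 from rfl]
    rw [rieszTail_zero_eq_one_add, mul_add, mul_one, smul_add]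
    nth_rewrite 1 [ih]
    ring

/-- The data of a Riesz product with lacunary frequencies `N i` of ratio at least `7`, whose
factors `u i + v i` have frequencies within `W` of `± N i`. -/
structure LacunaryFactors (N : ℕ → ℕ) (W : ℕ) (u v : ℕ → ℝ → ℂ) : Prop where
  pos : 0 < N 0
  width_le : W ≤ N 0
  lacunary : ∀ i, 7 * N i ≤ N (i + 1)
  mem_pos : ∀ i, u i ∈ band (N i - W) (N i + W)
  mem_neg : ∀ i, v i ∈ band (-N i - W) (-N i + W)
  norm_pos : ∀ i x, ‖u i x‖ ≤ 1 / 2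
  norm_neg : ∀ i x, ‖v i x‖ ≤ 1 / 2

/-- Truncated subtraction makes `j = 0` the only case with slack; there `t ≤ 1` is what is needed.
-/
theorem mul_pow_pred_le {t : ℝ} (h1 : t ≤ 1) (j : ℕ) : t * t ^ (j - 1) ≤ t ^ j := by
  cases j with
  | zero => simpa using h1
  | succ j => rw [Nat.add_sub_cancel, pow_succ']

namespace LacunaryFactors

variable {N : ℕ → ℕ} {W : ℕ} {u v : ℕ → ℝ → ℂ} {t : ℝ}

theorem pow_mul_le (H : LacunaryFactors N W u v) (K : ℕ) : 7 ^ K * N 0 ≤ N K := by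
  induction K with
  | zero => simp
  | succ K ih =>
    have := H.lacunary K
    rw [pow_succ]; nlinarith

theorem width_le' (H : LacunaryFactors N W u v) (K : ℕ) : W ≤ N K := by
  have h1 := H.pow_mul_le K
  have h2 : 1 ≤ 7 ^ K := Nat.one_le_pow _ _ (by norm_num)
  have := H.width_le
  nlinarith

/-- Each factor has modulus at most 1, so a recursion step at most doubles the bound. This crude
estimate serves only when few factors are present. -/
theorem norm_rieszTail_le (H : LacunaryFactors N W u v) (h0 : 0 ≤ t) (h1 : t ≤ 1) (K j : ℕ)
    (x : ℝ) : ‖rieszTail t (u + v) K j x‖ ≤ t ^ j * 2 ^ K := by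
  induction K generalizing j with
  | zero =>
    by_cases hj : j = 0
    · simp [rieszTail, hj]
    · simp [rieszTail, hj]; positivity
  | succ K ih =>
    have hh : ‖(u + v) K x‖ ≤ 1 := by
      have := norm_add_le (u K x) (v K x)
      have := H.norm_pos K x
      have := H.norm_neg K x
      simp only [Pi.add_apply]; linarith
    calc ‖rieszTail t (u + v) (K + 1) j x‖
        ≤ ‖rieszTail t (u + v) K j x‖ + ‖(t : ℂ) * ((u + v) K x * rieszTail t (u + v) K (j - 1) x)‖ :=
          norm_add_le _ _
      _ = ‖rieszTail t (u + v) K j x‖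
          + t * (‖(u + v) K x‖ * ‖rieszTail t (u + v) K (j - 1) x‖) := by
          rw [norm_mul, norm_mul, Complex.norm_real, Real.norm_of_nonneg h0]
      _ ≤ t ^ j * 2 ^ K + t * (1 * (t ^ (j - 1) * 2 ^ K)) := by
          gcongr
          · exact ih j
          · exact ih (j - 1)
      _ = t ^ j * 2 ^ K + (t * t ^ (j - 1)) * 2 ^ K := by ring
      _ ≤ t ^ j * 2 ^ K + t ^ j * 2 ^ K := by gcongr; exact mul_pow_pred_le h1 j
      _ = t ^ j * 2 ^ (K + 1) := by ring

/-- The ratio 7 is what closes this induction: if `3 Q ≤ N K` and `W ≤ N K`, then `3 (Q + N K + W) ≤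
7 N K ≤ N (K + 1)`. -/
theorem exists_rieszTail_mem_band (H : LacunaryFactors N W u v) (t : ℝ) (K : ℕ) :
    ∃ Q : ℤ, 0 ≤ Q ∧ 3 * Q ≤ N K ∧ ∀ j, rieszTail t (u + v) K j ∈ band (-Q) Q := by
  induction K with
  | zero =>
    refine ⟨0, le_rfl, by positivity, fun j => ?_⟩
    rw [rieszTail]
    split_ifs
    · exact one_mem_band (by simp) le_rfl
    · exact zero_mem _
  | succ K ih =>
    obtain ⟨Q, hQ, hQN, hT⟩ := ih
    have hW := H.width_le' K
    have hl := H.lacunary K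
    refine ⟨Q + N K + W, by positivity, by omega, fun j => ?_⟩
    rw [rieszTail]
    refine add_mem (band_mono (by omega) (by omega) (hT j)) (Submodule.smul_mem _ _ ?_)
    refine band_mono (a := -N K - W + -Q) (b := N K + W + Q) (by omega) (by omega)
      (mul_mem_band (add_mem ?_ ?_) (hT _))
    · exact band_mono (by omega) (by omega) (H.mem_pos K)
    · exact band_mono (by omega) (by omega) (H.mem_neg K)

/-- Pairing a function with spectrum in a band with the tail of a Riesz product: the bound does not
depend on the number of factors. -/
theorem norm_integral_mul_rieszTail_le (H : LacunaryFactors N W u v) (h0 : 0 ≤ t) (h1 : t ≤ 1)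
    (K j : ℕ) {α β : ℤ} (hαβ : α ≤ β) {P : ℝ → ℂ} (hP : P ∈ band α β) :
    ‖∫ x, (P * rieszTail t (u + v) K j) x ∂periodMeasure‖
      ≤ t ^ j * (6 * (β - α) / N 0 + 12) * ∫ x, ‖P x‖ ∂periodMeasure := by
  have hN0 : (0 : ℝ) < N 0 := by exact_mod_cast H.pos
  have hW0 : (W : ℝ) ≤ N 0 := by exact_mod_cast H.width_le
  induction K generalizing j α β P with
  | zero =>
    have hαβ' : (0 : ℝ) ≤ β - α := by rw [sub_nonneg]; exact_mod_cast hαβ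
    by_cases hj : j = 0
    · have hI : 0 ≤ ∫ x, ‖P x‖ ∂periodMeasure := integral_nonneg fun x => norm_nonneg _
      have h2 := norm_integral_le_integral_norm (μ := periodMeasure) P
      have h3 : 0 ≤ 6 * (β - α : ℝ) / N 0 := by positivity
      simp only [rieszTail, hj, if_true, mul_one, pow_zero, one_mul]
      nlinarith
    · simp only [rieszTail, hj, if_false, mul_zero, Pi.zero_apply, integral_zero, norm_zero]
      positivity
  | succ K ih =>
    have hαβ' : (0 : ℝ) ≤ β - α := by rw [sub_nonneg]; exact_mod_cast hαβ
    have hI : 0 ≤ ∫ x, ‖P x‖ ∂periodMeasure := integral_nonneg fun x => norm_nonneg _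
    -- Either the band of `P` is wide compared with the top frequency and the crude bound suffices,
    -- or it is so narrow that the terms of the top factor separate spectrally.
    by_cases hK : (N K : ℤ) ≤ 3 * (β - α) + 3 * W
    · have hb : ∀ x, ‖(P * rieszTail t (u + v) (K + 1) j) x‖
          ≤ t ^ j * 2 ^ (K + 1) * ‖P x‖ := fun x => by
        rw [Pi.mul_apply, norm_mul, mul_comm]
        gcongr
        exact H.norm_rieszTail_le h0 h1 _ _ _
      -- Exponential growth of the frequencies absorbs the doubling: `2 ^ (K + 1) ≤ 2 * 7 ^ K ≤ 2 *
      -- N K / N 0`.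
      have hpow : (2 : ℝ) ^ (K + 1) ≤ 6 * (β - α) / N 0 + 12 := by
        have h2 : (2 : ℝ) ^ K ≤ 7 ^ K := by gcongr; norm_num
        have h3 : (7 : ℝ) ^ K * N 0 ≤ N K := by exact_mod_cast H.pow_mul_le K
        have h4 : (N K : ℝ) ≤ 3 * (β - α) + 3 * W := by exact_mod_cast hK
        have h5 : 6 * (β - α : ℝ) / N 0 + 12 = (6 * (β - α) + 12 * N 0) / N 0 := by field_simp
        rw [h5, le_div_iff₀ hN0, pow_succ]
        have := mul_le_mul_of_nonneg_right h2 hN0.le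
        linarith
      calc _ ≤ ∫ x, t ^ j * 2 ^ (K + 1) * ‖P x‖ ∂periodMeasure :=
            norm_integral_le_of_norm_le
              ((integrable_period (continuous_of_mem_band hP).norm).const_mul _)
              (Filter.Eventually.of_forall hb)
        _ = t ^ j * 2 ^ (K + 1) * ∫ x, ‖P x‖ ∂periodMeasure := integral_const_mul _ _
        _ ≤ _ := by gcongr
    · push Not at hK
      obtain ⟨Q, hQ, hQN, hT⟩ := H.exists_rieszTail_mem_band t K
      have hWK := H.width_le' K
      have hPu := mul_mem_band hP (H.mem_pos K)
      have hPv := mul_mem_band hP (H.mem_neg K)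
      have m0 := mul_mem_band hP (hT j)
      have m1 := mul_mem_band hPu (hT (j - 1))
      have m2 := mul_mem_band hPv (hT (j - 1))
      have hsplit : ∫ x, (P * rieszTail t (u + v) (K + 1) j) x ∂periodMeasure
          = (∫ x, (P * rieszTail t (u + v) K j) x ∂periodMeasure)
            + (t : ℂ) * (∫ x, (P * u K * rieszTail t (u + v) K (j - 1)) x ∂periodMeasure)
            + (t : ℂ) * (∫ x, (P * v K * rieszTail t (u + v) K (j - 1)) x ∂periodMeasure) := by
        have i0 := integrable_period (continuous_of_mem_band m0)
        have i1 := (integrable_period (continuous_of_mem_band m1)).const_mul (t : ℂ)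
        have i2 := (integrable_period (continuous_of_mem_band m2)).const_mul (t : ℂ)
        rw [← integral_const_mul, ← integral_const_mul, ← integral_add i0 i1]
        refine Eq.trans ?_ (integral_add (i0.add i1) i2)
        congr 1; funext x
        simp [rieszTail]; ring
      have hside : ∀ w : ℝ → ℂ, Continuous w → (∀ x, ‖w x‖ ≤ 1 / 2) → ∀ a b : ℤ, a ≤ b →
          (b : ℝ) - a = β - α + 2 * W → P * w ∈ band a b →
          ‖(t : ℂ) * (∫ x, (P * w * rieszTail t (u + v) K (j - 1)) x ∂periodMeasure)‖
            ≤ t ^ j * (6 * (β - α) / N 0 + 12) * ∫ x, ‖P x‖ ∂periodMeasure := by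
        intro w hwc hw a b hab hlen hm
        have hPw : ∫ x, ‖(P * w) x‖ ∂periodMeasure ≤ 1 / 2 * ∫ x, ‖P x‖ ∂periodMeasure := by
          rw [← integral_const_mul]
          refine integral_mono (integrable_period (continuous_of_mem_band hm).norm)
            ((integrable_period (continuous_of_mem_band hP).norm).const_mul _) fun x => ?_
          simp only [Pi.mul_apply, norm_mul]
          rw [mul_comm]
          exact mul_le_mul_of_nonneg_right (hw x) (norm_nonneg _)
        -- Multiplication by `w` widens the band by `2 W ≤ 2 N 0`, which at most doubles this
        -- constant; the halved `L¹` norm compensates exactly, so nothing accumulates over the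
        -- induction.
        have hlen' : 6 * ((b : ℝ) - a) / N 0 + 12 ≤ 2 * (6 * (β - α) / N 0 + 12) := by
          have h3 : (W : ℝ) / N 0 ≤ 1 := (div_le_one hN0).2 hW0
          have h4 : 6 * ((b : ℝ) - a) / N 0 = 6 * (β - α) / N 0 + 12 * (W / N 0) := by
            rw [hlen]; ring
          have : 0 ≤ 6 * (β - α : ℝ) / N 0 := by positivity
          linarith
        have hab' : (0 : ℝ) ≤ b - a := by rw [sub_nonneg]; exact_mod_cast hab
        rw [norm_mul, Complex.norm_real, Real.norm_of_nonneg h0]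
        calc t * _ ≤ t * (t ^ (j - 1) * (6 * ((b : ℝ) - a) / N 0 + 12)
              * ∫ x, ‖(P * w) x‖ ∂periodMeasure) := by gcongr; exact ih (j - 1) hab hm
          _ ≤ t * (t ^ (j - 1) * (2 * (6 * (β - α) / N 0 + 12))
              * (1 / 2 * ∫ x, ‖P x‖ ∂periodMeasure)) := by gcongr
          _ = (t * t ^ (j - 1)) * (6 * (β - α) / N 0 + 12) * ∫ x, ‖P x‖ ∂periodMeasure := by ring
          _ ≤ _ := by gcongr; exact mul_pow_pred_le h1 j
      have hu := hside (u K) (continuous_of_mem_band (H.mem_pos K)) (H.norm_pos K) _ _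
        (by omega) (by push_cast; ring) hPu
      have hv := hside (v K) (continuous_of_mem_band (H.mem_neg K)) (H.norm_neg K) _ _
        (by omega) (by push_cast; ring) hPv
      rw [hsplit]
      -- The three bands are centred `N K` apart. From `3 Q ≤ N K` and `3 (β - α) + 3 W < N K`, at
      -- most one of them contains 0, so at most one integral survives.
      by_cases c0 : 0 < α + -Q ∨ β + Q < 0
      · rw [integral_eq_zero_of_mem_band m0 c0, zero_add]
        by_cases c1 : 0 < α + (N K - W) + -Q ∨ β + (N K + W) + Q < 0
        · rw [integral_eq_zero_of_mem_band m1 c1, mul_zero, zero_add]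
          exact hv
        · rw [integral_eq_zero_of_mem_band m2 (by omega), mul_zero, add_zero]
          exact hu
      · rw [integral_eq_zero_of_mem_band m1 (by omega),
          integral_eq_zero_of_mem_band m2 (by omega), mul_zero, add_zero, add_zero]
        exact ih j hαβ hP

end LacunaryFactors

/-! ### Dirichlet and de la Vallée-Poussin kernels -/

/-- The Dirichlet kernel `∑_{|k| ≤ N} exp (i k x)`. -/
noncomputable def dirichletKer (N : ℕ) (x : ℝ) : ℝ :=
  1 + ∑ k ∈ Finset.range N, 2 * Real.cos ((k + 1 : ℕ) * x)

/-- The de la Vallée-Poussin kernel: the mean of the Dirichlet kernels of orders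
`d, …, d + M - 1`. -/
noncomputable def valleePoussinKer (d M : ℕ) (x : ℝ) : ℝ :=
  (∑ i ∈ Finset.range M, dirichletKer (d + i) x) / M

theorem dirichletKer_succ (N : ℕ) (x : ℝ) :
    dirichletKer (N + 1) x = dirichletKer N x + 2 * Real.cos ((N + 1 : ℕ) * x) := by
  rw [dirichletKer, dirichletKer, Finset.sum_range_succ, add_assoc]

theorem continuous_dirichletKer (N : ℕ) : Continuous (dirichletKer N) := by
  unfold dirichletKer; fun_prop

theorem continuous_valleePoussinKer (d M : ℕ) : Continuous (valleePoussinKer d M) := by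
  have := continuous_dirichletKer
  unfold valleePoussinKer; fun_prop

theorem abs_dirichletKer_le (N : ℕ) (x : ℝ) : |dirichletKer N x| ≤ 2 * N + 1 := by
  induction N with
  | zero => simp [dirichletKer]
  | succ N ih =>
    rw [dirichletKer_succ]
    have h1 := abs_add_le (dirichletKer N x) (2 * Real.cos ((N + 1 : ℕ) * x))
    have h2 := Real.abs_cos_le_one ((N + 1 : ℕ) * x)
    rw [abs_mul, abs_two] at h1
    push_cast at *
    linarith

theorem dirichletKer_mul_sin (N : ℕ) (x : ℝ) :
    dirichletKer N x * Real.sin (x / 2) = Real.sin (N * x + x / 2) := by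
  induction N with
  | zero => simp [dirichletKer]
  | succ N ih =>
    rw [dirichletKer_succ, add_mul, ih]
    have h1 : (N : ℝ) * x + x / 2 = (N + 1 : ℕ) * x - x / 2 := by push_cast; ring
    rw [h1, Real.sin_sub, Real.sin_add]
    ring

/-- Multiplied by `2 sin² (x / 2)`, each Dirichlet kernel becomes a difference of consecutive
cosines, and the sum telescopes. This is the source of the `1 / (M x²)` decay. -/
theorem valleePoussinKer_mul_sin_sq {d M : ℕ} (hM : 1 ≤ M) (x : ℝ) :
    M * valleePoussinKer d M x * (2 * Real.sin (x / 2) ^ 2)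
      = Real.cos (d * x) - Real.cos ((d + M : ℕ) * x) := by
  have hM' : (M : ℝ) ≠ 0 := by positivity
  rw [valleePoussinKer, mul_div_cancel₀ _ hM']
  clear hM hM'
  induction M with
  | zero => simp
  | succ M ih =>
    rw [Finset.sum_range_succ, add_mul, ih]
    have h1 : dirichletKer (d + M) x * (2 * Real.sin (x / 2) ^ 2)
        = 2 * Real.sin (x / 2) * Real.sin ((d + M : ℕ) * x + x / 2) := by
      rw [← dirichletKer_mul_sin]; ring
    have h2 : ((d + M : ℕ) : ℝ) * x = ((d + M : ℕ) * x + x / 2) - x / 2 := by ring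
    have h3 : ((d + (M + 1) : ℕ) : ℝ) * x = ((d + M : ℕ) * x + x / 2) + x / 2 := by push_cast; ring
    rw [h1, h3, Real.cos_add _ (x / 2)]
    nth_rewrite 1 [h2]
    rw [Real.cos_sub _ (x / 2)]
    ring

theorem div_pi_le_sin_half {x : ℝ} (h0 : 0 ≤ x) (h1 : x ≤ π) : x / π ≤ Real.sin (x / 2) := by
  have := Real.mul_le_sin (x := x / 2) (by positivity) (by linarith)
  calc x / π = 2 / π * (x / 2) := by ring
    _ ≤ _ := this

theorem abs_dirichletKer_le_div (N : ℕ) {x : ℝ} (h0 : 0 < x) (h1 : x ≤ π) :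
    |dirichletKer N x| ≤ π * x⁻¹ := by
  have hs := div_pi_le_sin_half h0.le h1
  have hp : 0 < x / π := by positivity
  have h2 := Real.abs_sin_le_one (N * x + x / 2)
  rw [← dirichletKer_mul_sin, abs_mul, abs_of_pos (hp.trans_le hs)] at h2
  have h3 : |dirichletKer N x| * (x / π) ≤ 1 :=
    (mul_le_mul_of_nonneg_left hs (abs_nonneg _)).trans h2
  calc |dirichletKer N x| ≤ 1 / (x / π) := (le_div_iff₀ hp).2 h3
    _ = π * x⁻¹ := by field_simp

theorem abs_valleePoussinKer_le_of_forall {d M : ℕ} (hM : 1 ≤ M) {x B : ℝ}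
    (h : ∀ i < M, |dirichletKer (d + i) x| ≤ B) : |valleePoussinKer d M x| ≤ B := by
  have hM' : (0 : ℝ) < M := by positivity
  rw [valleePoussinKer, abs_div, abs_of_pos hM', div_le_iff₀ hM']
  calc _ ≤ ∑ i ∈ Finset.range M, |dirichletKer (d + i) x| := Finset.abs_sum_le_sum_abs _ _
    _ ≤ ∑ i ∈ Finset.range M, B := Finset.sum_le_sum fun i hi => h i (Finset.mem_range.1 hi)
    _ = B * M := by simp [mul_comm]

theorem abs_valleePoussinKer_le {d M : ℕ} (hM : 1 ≤ M) (x : ℝ) :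
    |valleePoussinKer d M x| ≤ 2 * (d + M : ℕ) := by
  refine abs_valleePoussinKer_le_of_forall hM fun i hi => (abs_dirichletKer_le _ _).trans ?_
  have : (i : ℝ) + 1 ≤ M := by exact_mod_cast hi
  push_cast; linarith

theorem abs_valleePoussinKer_le_div {d M : ℕ} (hM : 1 ≤ M) {x : ℝ} (h0 : 0 < x) (h1 : x ≤ π) :
    |valleePoussinKer d M x| ≤ π * x⁻¹ :=
  abs_valleePoussinKer_le_of_forall hM fun _ _ => abs_dirichletKer_le_div _ h0 h1

theorem abs_valleePoussinKer_le_div_sq {d M : ℕ} (hM : 1 ≤ M) {x : ℝ} (h0 : 0 < x) (h1 : x ≤ π) :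
    |valleePoussinKer d M x| ≤ π ^ 2 / M * x ^ (-2 : ℤ) := by
  have hM' : (0 : ℝ) < M := by positivity
  have hs := div_pi_le_sin_half h0.le h1
  have hp : 0 < x / π := by positivity
  have hs2 : (x / π) ^ 2 ≤ Real.sin (x / 2) ^ 2 := by gcongr
  have h2 := congrArg abs (valleePoussinKer_mul_sin_sq (d := d) hM x)
  rw [abs_mul, abs_mul, abs_of_pos hM', abs_of_nonneg (by positivity : 0 ≤ 2 * sin (x / 2) ^ 2)]
    at h2
  have h3 : |Real.cos (d * x) - Real.cos ((d + M : ℕ) * x)| ≤ 2 := by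
    have := Real.cos_le_one (d * x)
    have := Real.neg_one_le_cos (d * x)
    have := Real.cos_le_one ((d + M : ℕ) * x)
    have := Real.neg_one_le_cos ((d + M : ℕ) * x)
    rw [abs_le]; constructor <;> linarith
  have h4 : |valleePoussinKer d M x| * (M * (x / π) ^ 2) ≤ 1 := by
    have := mul_le_mul_of_nonneg_left hs2 (by positivity : 0 ≤ M * |valleePoussinKer d M x|)
    linarith
  calc _ ≤ 1 / (M * (x / π) ^ 2) := (le_div_iff₀ (by positivity)).2 h4
    _ = π ^ 2 / M * x ^ (-2 : ℤ) := by rw [zpow_neg]; field_simp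

/-- The half-period is cut at `1 / (d + M)` and `1 / M`. The uniform bound, the `π / x` bound and
the `π² / (M x²)` bound give the three summands; only the middle range is logarithmic. -/
theorem integral_abs_valleePoussinKer_zero_pi_le {d M : ℕ} (hM : 1 ≤ M) :
    ∫ x in (0 : ℝ)..π, |valleePoussinKer d M x| ≤ 2 + π * log ((d + M) / M) + π ^ 2 := by
  have hc : Continuous fun x => |valleePoussinKer d M x| := (continuous_valleePoussinKer d M).abs
  have hM1 : (1 : ℝ) ≤ M := by exact_mod_cast hM
  have hM' : (0 : ℝ) < M := by positivity
  have hb : (0 : ℝ) < d + M := by positivity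
  have hbM : (1 : ℝ) / (d + M) ≤ 1 / M := by gcongr; linarith [(Nat.cast_nonneg d : (0:ℝ) ≤ d)]
  have hMπ : (1 : ℝ) / M ≤ π := by
    have : (1 : ℝ) / M ≤ 1 := (div_le_one hM').2 hM1
    linarith [Real.pi_gt_three]
  have hb0 : (0 : ℝ) < 1 / (d + M) := by positivity
  have hM0 : (0 : ℝ) < 1 / M := by positivity
  have hn1 : (0 : ℝ) ∉ Set.uIcc (1 / (d + M : ℝ)) (1 / M) := Set.notMem_uIcc_of_lt hb0 hM0
  have hn2 : (0 : ℝ) ∉ Set.uIcc (1 / (M : ℝ)) π := Set.notMem_uIcc_of_lt hM0 Real.pi_pos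
  rw [← intervalIntegral.integral_add_adjacent_intervals (hc.intervalIntegrable 0 (1 / M))
      (hc.intervalIntegrable (1 / M) π),
    ← intervalIntegral.integral_add_adjacent_intervals (hc.intervalIntegrable 0 (1 / (d + M)))
      (hc.intervalIntegrable (1 / (d + M)) (1 / M))]
  refine add_le_add (add_le_add ?_ ?_) ?_
  · calc _ ≤ ∫ x in (0 : ℝ)..(1 / (d + M)), (2 * (d + M) : ℝ) :=
          intervalIntegral.integral_mono_on hb0.le (hc.intervalIntegrable _ _) (by simp)
            fun x _ => by simpa using abs_valleePoussinKer_le hM x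
      _ = 2 := by rw [intervalIntegral.integral_const, smul_eq_mul]; field_simp; ring
  · have hi : IntervalIntegrable (fun x : ℝ => x⁻¹) volume (1 / (d + M)) (1 / M) :=
      intervalIntegrable_inv_iff.2 (Or.inr hn1)
    calc _ ≤ ∫ x in (1 / (d + M : ℝ))..(1 / M), π * x⁻¹ :=
          intervalIntegral.integral_mono_on hbM (hc.intervalIntegrable _ _) (hi.const_mul _)
            fun x hx => abs_valleePoussinKer_le_div hM (hb0.trans_le hx.1) (hx.2.trans hMπ)
      _ = π * log ((d + M) / M) := by
          rw [intervalIntegral.integral_const_mul, integral_inv_of_pos hb0 hM0]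
          congr 2; field_simp
  · have hi : IntervalIntegrable (fun x : ℝ => x ^ (-2 : ℤ)) volume (1 / M) π :=
      intervalIntegral.intervalIntegrable_zpow (Or.inr hn2)
    calc _ ≤ ∫ x in (1 / M : ℝ)..π, π ^ 2 / M * x ^ (-2 : ℤ) :=
          intervalIntegral.integral_mono_on hMπ (hc.intervalIntegrable _ _) (hi.const_mul _)
            fun x hx => abs_valleePoussinKer_le_div_sq hM (hM0.trans_le hx.1) hx.2
      _ = π ^ 2 / M * (M - π⁻¹) := by
          rw [intervalIntegral.integral_const_mul, integral_zpow (Or.inr ⟨by norm_num, hn2⟩)]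
          norm_num
          left
          norm_cast
          simp [div_neg]
      _ ≤ π ^ 2 / M * M := by gcongr; linarith [inv_pos.2 Real.pi_pos]
      _ = π ^ 2 := by field_simp

theorem dirichletKer_neg (N : ℕ) (x : ℝ) : dirichletKer N (-x) = dirichletKer N x := by
  simp [dirichletKer]

theorem valleePoussinKer_neg (d M : ℕ) (x : ℝ) :
    valleePoussinKer d M (-x) = valleePoussinKer d M x := by
  simp [valleePoussinKer, dirichletKer_neg]

theorem valleePoussinKer_periodic (d M : ℕ) :
    Function.Periodic (valleePoussinKer d M) (2 * π) := by
  intro x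
  simp only [valleePoussinKer, dirichletKer, mul_add, Real.cos_add_nat_mul_two_pi]

theorem integral_abs_valleePoussinKer_sub_le {d M : ℕ} (hM : 1 ≤ M) (x : ℝ) :
    ∫ y, |valleePoussinKer d M (x - y)| ∂periodMeasure ≤ 26 * (1 + log ((d + M) / M)) := by
  have hc : Continuous fun x => |valleePoussinKer d M x| := (continuous_valleePoussinKer d M).abs
  have hper : Function.Periodic (fun x => |valleePoussinKer d M x|) (2 * π) := fun x => by
    simp only [valleePoussinKer_periodic d M x]
  have h1 : ∫ y, |valleePoussinKer d M (x - y)| ∂periodMeasure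
      = ∫ y in (-π)..π, |valleePoussinKer d M y| := by
    rw [integral_period, intervalIntegral.integral_comp_sub_left
      (fun y => |valleePoussinKer d M y|) x]
    have := hper.intervalIntegral_add_eq (x - 2 * π) (-π)
    rw [show x - 2 * π + 2 * π = x by ring, show -π + 2 * π = π by ring] at this
    simpa using this
  have h2 : ∫ y in (-π)..0, |valleePoussinKer d M y| = ∫ y in (0 : ℝ)..π, |valleePoussinKer d M y| := by
    have := intervalIntegral.integral_comp_neg (a := 0) (b := π) fun y => |valleePoussinKer d M y|
    simp only [valleePoussinKer_neg, neg_zero] at this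
    exact this.symm
  have h3 := integral_abs_valleePoussinKer_zero_pi_le (d := d) hM
  have hlog : 0 ≤ log ((d + M : ℝ) / M) := by
    have hM' : (0 : ℝ) < M := by positivity
    apply Real.log_nonneg
    rw [le_div_iff₀ hM']
    linarith [(Nat.cast_nonneg d : (0:ℝ) ≤ d)]
  rw [h1, ← intervalIntegral.integral_add_adjacent_intervals (hc.intervalIntegrable (-π) 0)
    (hc.intervalIntegrable 0 π), h2]
  -- Doubling the half-period bound gives `4 + 2 π² + 2 π log`, and 26 dominates both `4 + 2 π²` and
  -- `2 π`.
  nlinarith [Real.pi_lt_d2, Real.pi_pos]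

theorem ofReal_dirichletKer_succ (N : ℕ) (x : ℝ) :
    (dirichletKer (N + 1) x : ℂ)
      = dirichletKer N x + (expMode (N + 1 : ℕ) x + expMode (-(N + 1 : ℕ)) x) := by
  rw [dirichletKer_succ, Complex.ofReal_add, Complex.ofReal_mul, cos_mul_eq_expMode]
  push_cast; ring

theorem integral_expMode_sub_mul (k j : ℤ) (y : ℝ) :
    ∫ x, expMode k (x - y) * expMode j x ∂periodMeasure
      = if k + j = 0 then 2 * π * expMode j y else 0 := by
  have h : ∀ x, expMode k (x - y) * expMode j x = expMode (-k) y * expMode (k + j) x := fun x => by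
    rw [expMode_sub, ← expMode_mul k j, Pi.mul_apply]; ring
  simp only [h]
  rw [integral_const_mul, integral_expMode]
  split_ifs with hk
  · rw [show -k = j by omega]; ring
  · simp

theorem integral_dirichletKer_sub_mul_expMode (N : ℕ) (j : ℤ) (y : ℝ) :
    ∫ x, (dirichletKer N (x - y) : ℂ) * expMode j x ∂periodMeasure
      = if |j| ≤ N then 2 * π * expMode j y else 0 := by
  induction N with
  | zero =>
    have := integral_expMode_sub_mul 0 j y
    simpa [expMode_zero, dirichletKer] using this
  | succ N ih =>
    have c1 := continuous_dirichletKer N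
    have c2 := continuous_expMode
    have i1 : Integrable (fun x => (dirichletKer N (x - y) : ℂ) * expMode j x) periodMeasure :=
      integrable_period (by fun_prop)
    have i2 : ∀ k, Integrable (fun x => expMode k (x - y) * expMode j x) periodMeasure :=
      fun k => integrable_period (by have := c2 k; have := c2 j; fun_prop)
    simp only [ofReal_dirichletKer_succ, add_mul]
    refine (integral_add i1 ((i2 _).add (i2 _))).trans ?_
    simp only [Pi.add_apply]
    rw [integral_add (i2 _) (i2 _), ih,
      integral_expMode_sub_mul, integral_expMode_sub_mul]
    have hj := abs_cases j
    rcases lt_trichotomy |j| (N + 1 : ℕ) with h | h | h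
    · rw [if_pos (by omega), if_neg (by omega), if_neg (by omega), if_pos (by omega)]; ring
    · rw [if_neg (by omega)]
      rcases hj with hj | hj
      · rw [if_neg (by omega), if_pos (by omega), if_pos (by omega)]; ring
      · rw [if_pos (by omega), if_neg (by omega), if_pos (by omega)]; ring
    · rw [if_neg (by omega), if_neg (by omega), if_neg (by omega), if_neg (by omega)]; ring

theorem integral_dirichletKer_sub_mul {d N : ℕ} (hdN : d ≤ N) {f : ℝ → ℂ} (hf : f ∈ band (-d) d)
    (y : ℝ) : ∫ x, (dirichletKer N (x - y) : ℂ) * f x ∂periodMeasure = 2 * π * f y := by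
  have c1 := continuous_dirichletKer N
  induction hf using Submodule.span_induction with
  | mem x hx =>
    obtain ⟨j, hj, rfl⟩ := hx
    rw [integral_dirichletKer_sub_mul_expMode, if_pos]
    have := hj.1; have := hj.2; rw [abs_le]; omega
  | zero => simp
  | add f g hf hg ihf ihg =>
    have := continuous_of_mem_band hf
    have := continuous_of_mem_band hg
    simp only [Pi.add_apply, mul_add]
    rw [integral_add (integrable_period (by fun_prop)) (integrable_period (by fun_prop)), ihf, ihg]
  | smul c f _ ih =>
    simp only [Pi.smul_apply, smul_eq_mul, mul_left_comm _ c]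
    rw [integral_const_mul, ih]

/-- Every Dirichlet kernel in the mean has order at least `d`, so each one already reproduces `p`.
-/
theorem integral_valleePoussinKer_sub_mul {d M : ℕ} (hM : 1 ≤ M) {p : ℝ → ℝ}
    (hp : (fun x => (p x : ℂ)) ∈ band (-d) d) (y : ℝ) :
    ∫ x, valleePoussinKer d M (x - y) * p x ∂periodMeasure = 2 * π * p y := by
  have hpc : Continuous p := by
    have := Complex.continuous_re.comp (continuous_of_mem_band hp)
    simpa [Function.comp_def] using this
  have c1 := continuous_dirichletKer
  have hD : ∀ i, ∫ x, dirichletKer (d + i) (x - y) * p x ∂periodMeasure = 2 * π * p y := fun i => by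
    have := integral_dirichletKer_sub_mul (N := d + i) (by omega) hp y
    have h2 : ∀ x, (dirichletKer (d + i) (x - y) : ℂ) * (p x : ℂ)
      = ((dirichletKer (d + i) (x - y) * p x : ℝ) : ℂ) := fun x => by push_cast; rfl
    simp only [h2] at this
    rw [integral_complex_ofReal] at this
    exact_mod_cast this
  have hM' : (M : ℝ) ≠ 0 := by positivity
  have : ∀ x, valleePoussinKer d M (x - y) * p x
      = (M : ℝ)⁻¹ * ∑ i ∈ Finset.range M, dirichletKer (d + i) (x - y) * p x := fun x => by
    rw [valleePoussinKer, ← Finset.sum_mul]; ring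
  simp only [this]
  rw [integral_const_mul, integral_finsetSum]
  · simp only [hD, Finset.sum_const, Finset.card_range, nsmul_eq_mul]
    field_simp
  · intro i _
    have := c1 (d + i)
    exact integrable_period (by fun_prop)

theorem dirichletKer_mem_band (N : ℕ) : (fun x => (dirichletKer N x : ℂ)) ∈ band (-N) N := by
  induction N with
  | zero =>
    have : (fun x => (dirichletKer 0 x : ℂ)) = 1 := by funext x; simp [dirichletKer]
    rw [this]; exact one_mem_band (by simp) (by simp)
  | succ N ih =>
    simp only [ofReal_dirichletKer_succ]
    exact add_mem (band_mono (by omega) (by omega) ih)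
      (add_mem (expMode_mem_band (by omega) (by omega)) (expMode_mem_band (by omega) (by omega)))

theorem valleePoussinKer_mem_band {d M W : ℕ} (hW : d + M ≤ W + 1) :
    (fun x => (valleePoussinKer d M x : ℂ)) ∈ band (-W) W := by
  have : (fun x => (valleePoussinKer d M x : ℂ))
      = (M : ℂ)⁻¹ • ∑ i ∈ Finset.range M, fun x => (dirichletKer (d + i) x : ℂ) := by
    funext x; simp [valleePoussinKer, div_eq_inv_mul]
  rw [this]
  refine Submodule.smul_mem _ _ (Submodule.sum_mem _ fun i hi => ?_)
  have := Finset.mem_range.1 hi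
  exact band_mono (by omega) (by omega) (dirichletKer_mem_band (d + i))

/-! ### Norming polynomials -/

theorem convolution_mem_band {a b : ℤ} {f : ℝ → ℂ} (hf : f ∈ band a b) {s : ℝ → ℂ}
    (hs : Measurable s) {C : ℝ} (hC : ∀ y, ‖s y‖ ≤ C) :
    (fun x => ∫ y, f (x - y) * s y ∂periodMeasure) ∈ band a b := by
  have hint : ∀ g : ℝ → ℂ, Continuous g → ∀ x,
      Integrable (fun y => g (x - y) * s y) periodMeasure := fun g hg x =>
    (integrable_period (by fun_prop : Continuous fun y => g (x - y))).mul_bdd (c := C)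
      hs.aestronglyMeasurable
      (Filter.Eventually.of_forall hC)
  induction hf using Submodule.span_induction with
  | mem f hf =>
    obtain ⟨j, hj, rfl⟩ := hf
    have : (fun x => ∫ y, expMode j (x - y) * s y ∂periodMeasure)
        = (∫ y, expMode (-j) y * s y ∂periodMeasure) • expMode j := by
      funext x
      simp only [expMode_sub, mul_assoc, Pi.smul_apply, smul_eq_mul]
      rw [integral_const_mul, mul_comm]
    rw [this]
    exact Submodule.smul_mem _ _ (expMode_mem_band hj.1 hj.2)
  | zero => simp only [Pi.zero_apply, zero_mul, integral_zero]; exact zero_mem (band a b)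
  | add f g hf hg ihf ihg =>
    have : (fun x => ∫ y, (f + g) (x - y) * s y ∂periodMeasure)
        = (fun x => ∫ y, f (x - y) * s y ∂periodMeasure)
          + fun x => ∫ y, g (x - y) * s y ∂periodMeasure := by
      funext x
      simp only [Pi.add_apply, add_mul]
      exact integral_add (hint f (continuous_of_mem_band hf) x)
        (hint g (continuous_of_mem_band hg) x)
    rw [this]
    exact add_mem ihf ihg
  | smul c f _ ih =>
    have : (fun x => ∫ y, (c • f) (x - y) * s y ∂periodMeasure)
        = c • fun x => ∫ y, f (x - y) * s y ∂periodMeasure := by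
      funext x
      simp only [Pi.smul_apply, smul_eq_mul, mul_assoc]
      rw [integral_const_mul]
    rw [this]
    exact Submodule.smul_mem _ _ ih

/-- A trigonometric polynomial of degree `d` is normed, up to a logarithmic factor, by a
trigonometric polynomial of degree less than `d + M` bounded by `1`. -/
theorem exists_band_norming {d M W : ℕ} (hM : 1 ≤ M) (hW : d + M ≤ W + 1) {p : ℝ → ℝ}
    (hp : (fun x => (p x : ℂ)) ∈ band (-d) d) :
    ∃ u : ℝ → ℝ, (fun x => (u x : ℂ)) ∈ band (-W) W ∧ (∀ x, |u x| ≤ 1) ∧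
      26 * (1 + log ((d + M) / M)) * ∫ x, p x * u x ∂periodMeasure
        = 2 * π * ∫ x, |p x| ∂periodMeasure := by
  set B : ℝ := 26 * (1 + log ((d + M) / M)) with hB
  have hBpos : 0 < B := by
    have hM' : (0 : ℝ) < M := by positivity
    have : 0 ≤ log ((d + M : ℝ) / M) := by
      apply Real.log_nonneg
      rw [le_div_iff₀ hM']
      linarith [(Nat.cast_nonneg d : (0:ℝ) ≤ d)]
    positivity
  have hpc : Continuous p := by
    have := Complex.continuous_re.comp (continuous_of_mem_band hp)
    simpa [Function.comp_def] using this
  have hVc := continuous_valleePoussinKer d M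
  -- The sign is set to 1 at zeros of `p`, so that `|s| = 1` everywhere.
  let s : ℝ → ℝ := fun y => if p y < 0 then -1 else 1
  have hsm : Measurable s :=
    Measurable.ite (measurableSet_lt hpc.measurable measurable_const) measurable_const
      measurable_const
  have hs1 : ∀ y, |s y| = 1 := fun y => by simp only [s]; split_ifs <;> simp
  have hps : ∀ y, p y * s y = |p y| := fun y => by
    simp only [s]; split_ifs with h
    · rw [abs_of_neg h]; ring
    · rw [abs_of_nonneg (not_lt.1 h), mul_one]
  have hconv : ∀ x, |∫ y, valleePoussinKer d M (x - y) * s y ∂periodMeasure| ≤ B := fun x =>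
    calc _ ≤ ∫ y, |valleePoussinKer d M (x - y) * s y| ∂periodMeasure := abs_integral_le_integral_abs
      _ = ∫ y, |valleePoussinKer d M (x - y)| ∂periodMeasure := by simp only [abs_mul, hs1, mul_one]
      _ ≤ B := integral_abs_valleePoussinKer_sub_le hM x
  -- Smoothing the sign puts it in the band; dividing by the kernel's norm bound keeps it below 1.
  refine ⟨fun x => B⁻¹ * ∫ y, valleePoussinKer d M (x - y) * s y ∂periodMeasure, ?_, ?_, ?_⟩
  · have h1 := convolution_mem_band (valleePoussinKer_mem_band hW) (s := fun y => (s y : ℂ))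
      (Complex.measurable_ofReal.comp hsm) (C := 1) (fun y => by simp [hs1])
    have h2 := Submodule.smul_mem _ (B⁻¹ : ℂ) h1
    convert h2 using 1
    funext x
    simp only [Pi.smul_apply, smul_eq_mul, ← Complex.ofReal_mul]
    rw [integral_complex_ofReal]
    push_cast; rfl
  · intro x
    rw [abs_mul, abs_of_pos (inv_pos.2 hBpos), inv_mul_le_iff₀ hBpos, mul_one]
    exact hconv x
  · have hint : Integrable (Function.uncurry fun x y => p x * (valleePoussinKer d M (x - y) * s y))
        (periodMeasure.prod periodMeasure) := by
      have hc : Continuous fun z : ℝ × ℝ => p z.1 * valleePoussinKer d M (z.1 - z.2) := by fun_prop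
      have h1 : Integrable (fun z : ℝ × ℝ => p z.1 * valleePoussinKer d M (z.1 - z.2))
          (periodMeasure.prod periodMeasure) := by
        rw [Measure.prod_restrict]
        exact hc.continuousOn.integrableOn_compact (isCompact_Icc.prod isCompact_Icc)
      have h2 := h1.mul_bdd (c := 1) (hsm.comp measurable_snd).aestronglyMeasurable
        (Filter.Eventually.of_forall fun z => (hs1 z.2).le)
      refine h2.congr (Filter.Eventually.of_forall fun z => ?_)
      simp [Function.uncurry, mul_assoc]
    have h1 : B * ∫ x, p x * (B⁻¹ * ∫ y, valleePoussinKer d M (x - y) * s y ∂periodMeasure)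
        ∂periodMeasure
        = ∫ x, ∫ y, p x * (valleePoussinKer d M (x - y) * s y) ∂periodMeasure ∂periodMeasure := by
      rw [← integral_const_mul]
      congr 1; funext x
      rw [integral_const_mul]; field_simp
    -- By Fubini the kernel moves from the sign onto `p`, which it reproduces, leaving `2 π ∫ p s =
    -- 2 π ∫ |p|`.
    rw [h1, integral_integral_swap hint, ← integral_const_mul]
    congr 1; funext y
    have h2 : ∀ x, p x * (valleePoussinKer d M (x - y) * s y)
        = s y * (valleePoussinKer d M (x - y) * p x) := fun x => by ring
    simp only [h2]
    rw [integral_const_mul, integral_valleePoussinKer_sub_mul hM hp, ← hps]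
    ring

/-! ### Modulated polynomials and their orthogonality -/

/-- `cos (k x)` or `sin (k x)`, according to the Boolean. -/
noncomputable def trigMode (τ : Bool) (k : ℕ) (x : ℝ) : ℝ :=
  if τ then Real.cos (k * x) else Real.sin (k * x)

theorem continuous_trigMode (τ : Bool) (k : ℕ) : Continuous (trigMode τ k) := by
  unfold trigMode; cases τ <;> simp <;> fun_prop

theorem abs_trigMode_le_one (τ : Bool) (k : ℕ) (x : ℝ) : |trigMode τ k x| ≤ 1 := by
  cases τ
  · simpa [trigMode] using Real.abs_sin_le_one _
  · simpa [trigMode] using Real.abs_cos_le_one _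

theorem trigMode_eq_expMode (τ : Bool) : ∃ A B : ℂ, ‖A‖ = 1 / 2 ∧ ‖B‖ = 1 / 2 ∧
    ∀ (k : ℕ) (x : ℝ), (trigMode τ k x : ℂ) = A * expMode k x + B * expMode (-k) x := by
  cases τ
  · exact ⟨-Complex.I / 2, Complex.I / 2, by simp, by simp, fun k x => by
      simpa [trigMode] using sin_mul_eq_expMode k x⟩
  · exact ⟨1 / 2, 1 / 2, by simp, by simp, fun k x => by
      simpa [trigMode] using cos_mul_eq_expMode k x⟩

theorem continuous_of_ofReal_mem_band {a b : ℤ} {g : ℝ → ℝ}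
    (hg : (fun x => (g x : ℂ)) ∈ band a b) : Continuous g := by
  have := Complex.continuous_re.comp (continuous_of_mem_band hg)
  simpa [Function.comp_def] using this

/-- Euler's formula separates the two spectral halves, near `k` and near `-k`. This is the form of a
Riesz factor and the form in which spectral vanishing applies. -/
theorem exists_modulation {w : ℕ} {g : ℝ → ℝ} (hg : (fun x => (g x : ℂ)) ∈ band (-w) w)
    (τ : Bool) (k : ℕ) : ∃ u v : ℝ → ℂ, u ∈ band (k - w) (k + w) ∧ v ∈ band (-k - w) (-k + w) ∧
      (∀ x, ‖u x‖ = 1 / 2 * |g x|) ∧ (∀ x, ‖v x‖ = 1 / 2 * |g x|) ∧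
      ∀ x, ((g x * trigMode τ k x : ℝ) : ℂ) = u x + v x := by
  obtain ⟨A, B, hA, hB, h⟩ := trigMode_eq_expMode τ
  have m1 := mul_mem_band (expMode_mem_band (le_refl (k : ℤ)) le_rfl) hg
  have m2 := mul_mem_band (expMode_mem_band (le_refl (-k : ℤ)) le_rfl) hg
  refine ⟨_, _, Submodule.smul_mem _ A m1, Submodule.smul_mem _ B m2, fun x => ?_, fun x => ?_,
    fun x => ?_⟩
  · simp only [Pi.smul_apply, Pi.mul_apply, smul_eq_mul, norm_mul, hA, norm_expMode,
      Complex.norm_real, Real.norm_eq_abs, one_mul]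
  · simp only [Pi.smul_apply, Pi.mul_apply, smul_eq_mul, norm_mul, hB, norm_expMode,
      Complex.norm_real, Real.norm_eq_abs, one_mul]
  · simp only [Pi.smul_apply, Pi.mul_apply, smul_eq_mul]
    rw [Complex.ofReal_mul, h]; ring

theorem integral_mul_trigMode_eq_zero {w k : ℕ} {g : ℝ → ℝ}
    (hg : (fun x => (g x : ℂ)) ∈ band (-w) w) (τ : Bool) (hk : w < k) :
    ∫ x, g x * trigMode τ k x ∂periodMeasure = 0 := by
  obtain ⟨u, v, hu, hv, -, -, h⟩ := exists_modulation hg τ k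
  rw [← Complex.ofReal_inj, ← integral_complex_ofReal]
  simp only [h]
  rw [integral_add (integrable_period (continuous_of_mem_band hu))
    (integrable_period (continuous_of_mem_band hv)), integral_eq_zero_of_mem_band hu (by omega),
    integral_eq_zero_of_mem_band hv (by omega)]
  simp

theorem ofReal_mul_mem_band {d w : ℕ} {p g : ℝ → ℝ} (hp : (fun x => (p x : ℂ)) ∈ band (-d) d)
    (hg : (fun x => (g x : ℂ)) ∈ band (-w) w) :
    (fun x => ((p x * g x : ℝ) : ℂ)) ∈ band (-(d + w : ℕ)) (d + w : ℕ) := by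
  have h := mul_mem_band hp hg
  have e : (fun x => ((p x * g x : ℝ) : ℂ)) = (fun x => (p x : ℂ)) * fun x => (g x : ℂ) := by
    funext x; simp
  rw [e]
  exact band_mono (by push_cast; omega) (by push_cast; omega) h

/-- The product splits into four bands centred at `± n ± k` with half-width `d + w`; the two
conditions keep 0 out of all of them. -/
theorem integral_mul_trigMode_mul_trigMode_of_ne {d w n k : ℕ} {p g : ℝ → ℝ}
    (hp : (fun x => (p x : ℂ)) ∈ band (-d) d) (hg : (fun x => (g x : ℂ)) ∈ band (-w) w)
    (σ τ : Bool) (h1 : d + w < n + k) (h2 : n + d + w < k ∨ k + d + w < n) :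
    ∫ x, p x * trigMode σ n x * (g x * trigMode τ k x) ∂periodMeasure = 0 := by
  obtain ⟨u, v, hu, hv, -, -, h⟩ := exists_modulation hp σ n
  obtain ⟨u', v', hu', hv', -, -, h'⟩ := exists_modulation hg τ k
  have m1 := mul_mem_band hu hu'
  have m2 := mul_mem_band hu hv'
  have m3 := mul_mem_band hv hu'
  have m4 := mul_mem_band hv hv'
  have i1 := integrable_period (continuous_of_mem_band m1)
  have i2 := integrable_period (continuous_of_mem_band m2)
  have i3 := integrable_period (continuous_of_mem_band m3)
  have i4 := integrable_period (continuous_of_mem_band m4)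
  have key : ∀ x, ((p x * trigMode σ n x * (g x * trigMode τ k x) : ℝ) : ℂ)
      = (u * u' + u * v' + (v * u' + v * v')) x := fun x => by
    rw [Complex.ofReal_mul, h, h']; simp only [Pi.add_apply, Pi.mul_apply]; ring
  rw [← Complex.ofReal_inj, ← integral_complex_ofReal]
  simp only [key]
  rw [integral_add' (i1.add i2) (i3.add i4), integral_add' i1 i2, integral_add' i3 i4,
    integral_eq_zero_of_mem_band m1 (by omega), integral_eq_zero_of_mem_band m2 (by omega),
    integral_eq_zero_of_mem_band m3 (by omega), integral_eq_zero_of_mem_band m4 (by omega)]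
  simp

theorem trigMode_mul_self (τ : Bool) (k : ℕ) (x : ℝ) :
    trigMode τ k x * trigMode τ k x
      = 1 / 2 + (if τ then 1 / 2 else -1 / 2) * trigMode true (2 * k) x := by
  have h1 : ((2 * k : ℕ) : ℝ) * x = 2 * (k * x) := by push_cast; ring
  have h2 := Real.sin_sq_add_cos_sq (k * x)
  cases τ
  · simp only [trigMode, h1, Real.cos_two_mul]; simp; linarith
  · simp only [trigMode, h1, Real.cos_two_mul]; simp; ring

theorem trigMode_mul_not (τ : Bool) (k : ℕ) (x : ℝ) :
    trigMode (!τ) k x * trigMode τ k x = 1 / 2 * trigMode false (2 * k) x := by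
  have h1 : ((2 * k : ℕ) : ℝ) * x = 2 * (k * x) := by push_cast; ring
  cases τ <;> simp only [trigMode, h1, Real.sin_two_mul] <;> simp <;> ring

theorem integral_mul_trigMode_mul_trigMode_self {d w k : ℕ} {p g : ℝ → ℝ}
    (hp : (fun x => (p x : ℂ)) ∈ band (-d) d) (hg : (fun x => (g x : ℂ)) ∈ band (-w) w)
    (σ τ : Bool) (h1 : d + w < 2 * k) :
    ∫ x, p x * trigMode σ k x * (g x * trigMode τ k x) ∂periodMeasure
      = if σ = τ then 1 / 2 * ∫ x, p x * g x ∂periodMeasure else 0 := by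
  have hpg := ofReal_mul_mem_band hp hg
  have hc := continuous_of_ofReal_mem_band hpg
  have hz := fun ρ => integral_mul_trigMode_eq_zero hpg ρ h1
  have ht := continuous_trigMode true (2 * k)
  split_ifs with h
  · subst h
    have e : ∀ x, p x * trigMode σ k x * (g x * trigMode σ k x) = 1 / 2 * (p x * g x)
        + (if σ then 1 / 2 else -1 / 2) * (p x * g x * trigMode true (2 * k) x) := fun x => by
      have := trigMode_mul_self σ k x
      linear_combination p x * g x * this
    simp only [e]
    have hc2 : Continuous fun x => p x * g x * trigMode true (2 * k) x := hc.mul ht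
    rw [integral_add ((integrable_period hc).const_mul _)
      ((integrable_period hc2).const_mul _), integral_const_mul, integral_const_mul, hz,
      mul_zero, add_zero]
  · have hσ : σ = !τ := by cases σ <;> cases τ <;> simp_all
    have e : ∀ x, p x * trigMode σ k x * (g x * trigMode τ k x)
        = 1 / 2 * (p x * g x * trigMode false (2 * k) x) := fun x => by
      have := trigMode_mul_not τ k x
      rw [hσ]
      linear_combination p x * g x * this
    simp only [e]
    rw [integral_const_mul, hz, mul_zero]

/-! ### Testing against a Riesz product -/

theorem LacunaryFactors.norm_integral_mul_trigMode_mul_rieszTail_le {N : ℕ → ℕ} {W d : ℕ}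
    {u v : ℕ → ℝ → ℂ} {t : ℝ} (H : LacunaryFactors N W u v) (h0 : 0 ≤ t) (h1 : t ≤ 1)
    (hd : d ≤ W) {p : ℝ → ℝ} (hp : (fun x => (p x : ℂ)) ∈ band (-d) d) (σ : Bool) (n K j : ℕ) :
    ‖∫ x, ((p x * trigMode σ n x : ℝ) : ℂ) * rieszTail t (u + v) K j x ∂periodMeasure‖
      ≤ 24 * t ^ j * ∫ x, |p x| ∂periodMeasure := by
  obtain ⟨a, b, ha, hb, hna, hnb, h⟩ := exists_modulation hp σ n
  obtain ⟨Q, -, -, hQ⟩ := H.exists_rieszTail_mem_band t K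
  have hN0 : (0 : ℝ) < N 0 := by exact_mod_cast H.pos
  have hdN : (d : ℝ) ≤ N 0 := by exact_mod_cast hd.trans H.width_le
  have hI : 0 ≤ ∫ x, |p x| ∂periodMeasure := integral_nonneg fun x => abs_nonneg _
  have hone : ∀ (c : ℝ → ℂ) (α β : ℤ), α ≤ β → (β : ℝ) - α = 2 * d → c ∈ band α β →
      (∀ x, ‖c x‖ = 1 / 2 * |p x|) →
      ‖∫ x, (c * rieszTail t (u + v) K j) x ∂periodMeasure‖
        ≤ 12 * t ^ j * ∫ x, |p x| ∂periodMeasure := by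
    intro c α β hαβ hlen hc hn
    have h2 := H.norm_integral_mul_rieszTail_le h0 h1 K j hαβ hc
    simp only [hn, integral_const_mul, hlen] at h2
    have h3 : 6 * (2 * d : ℝ) / N 0 ≤ 12 := by rw [div_le_iff₀ hN0]; linarith
    calc _ ≤ _ := h2
      _ ≤ t ^ j * (12 + 12) * (1 / 2 * ∫ x, |p x| ∂periodMeasure) := by gcongr
      _ = _ := by ring
  simp only [h, add_mul]
  have e := integral_add (integrable_period (continuous_of_mem_band (mul_mem_band ha (hQ j))))
    (integrable_period (continuous_of_mem_band (mul_mem_band hb (hQ j))))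
  simp only [Pi.mul_apply] at e
  rw [e]
  have ea := hone a _ _ (by omega) (by push_cast; ring) ha hna
  have eb := hone b _ _ (by omega) (by push_cast; ring) hb hnb
  simp only [Pi.mul_apply] at ea eb
  linarith [norm_add_le (∫ x, a x * rieszTail t (u + v) K j x ∂periodMeasure)
    (∫ x, b x * rieszTail t (u + v) K j x ∂periodMeasure)]

/-- Testing a sum of modulated trigonometric polynomials against a Riesz product. -/
theorem riesz_product_test {ι : Type*} (s : Finset ι) {N : ℕ → ℕ} {d W : ℕ} (hd : d ≤ W)
    (hN : 0 < N 0) (hWN : W ≤ N 0) (hlac : ∀ i, 7 * N i ≤ N (i + 1))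
    {u : ℕ → ℝ → ℝ} (hu : ∀ i, (fun x => (u i x : ℂ)) ∈ band (-W) W) (hu1 : ∀ i x, |u i x| ≤ 1)
    (τ : Bool) {p : ι → ℝ → ℝ} (n : ι → ℕ) (σ : ι → Bool)
    (hp : ∀ a, (fun x => (p a x : ℂ)) ∈ band (-d) d) (hn : ∀ a ∈ s, d < n a) {B : ℝ}
    (hB : ∀ᵐ x ∂periodMeasure, ∑ a ∈ s, p a x * trigMode (σ a) (n a) x ≤ B)
    (K : ℕ) {t : ℝ} (h0 : 0 ≤ t) (h1 : t ≤ 1) :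
    t * ∑ i ∈ Finset.range K, ∑ a ∈ s,
        ∫ x, p a x * trigMode (σ a) (n a) x * (u i x * trigMode τ (N i) x) ∂periodMeasure
      - 24 * t ^ 2 * ∑ a ∈ s, ∫ x, |p a x| ∂periodMeasure ≤ 24 * π * |B| := by
  choose v w hv hw hnv hnw hvw using fun i => exists_modulation (hu i) τ (N i)
  have H : LacunaryFactors N W v w :=
    ⟨hN, hWN, hlac, hv, hw, fun i x => by rw [hnv]; linarith [hu1 i x],
      fun i x => by rw [hnw]; linarith [hu1 i x]⟩
  have hpc := fun a => continuous_of_ofReal_mem_band (hp a)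
  have huc := fun i => continuous_of_ofReal_mem_band (hu i)
  have htc := continuous_trigMode
  set h : ℕ → ℝ → ℝ := fun i x => u i x * trigMode τ (N i) x with hh
  have hhc : ∀ i, Continuous (h i) := fun i => (huc i).mul (htc _ _)
  set F : ι → ℝ → ℝ := fun a x => p a x * trigMode (σ a) (n a) x with hF
  have hFc : ∀ a, Continuous (F a) := fun a => (hpc a).mul (htc _ _)
  set G : ℝ → ℝ := fun x => ∏ i ∈ Finset.range K, (1 + t * h i x) with hG
  have hGc : Continuous G := continuous_finsetProd _ fun i _ => by have := hhc i; fun_prop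
  have hhT : ∀ i x, ((h i x : ℝ) : ℂ) = (v + w) i x := fun i x => hvw i x
  have hG0 : ∀ x, 0 ≤ G x := fun x => Finset.prod_nonneg fun i _ => by
    have h2 : |h i x| ≤ 1 := by
      rw [hh, abs_mul]
      exact mul_le_one₀ (hu1 i x) (abs_nonneg _) (abs_trigMode_le_one _ _ _)
    have h3 := neg_le_of_abs_le h2
    nlinarith
  have hGT : ∀ x, (G x : ℂ) = rieszTail t (v + w) K 0 x := fun x => by
    rw [rieszTail_zero_eq_prod, hG]
    push_cast
    simp only [hhT]
  set R : ℝ → ℝ := fun x => G x - 1 - ∑ i ∈ Finset.range K, t * h i x with hR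
  have hRc : Continuous R := by fun_prop
  have hRT : ∀ x, (R x : ℂ) = rieszTail t (v + w) K 2 x := fun x => by
    have e : rieszTail t (v + w) K 0 x = 1 + (∑ i ∈ Finset.range K, t * (v + w) i x
        + rieszTail t (v + w) K 2 x) := by
      rw [rieszTail_zero_eq_one_add, rieszTail_one_eq_sum_add]
      simp [mul_add]
    rw [hR]
    push_cast
    rw [hGT, e]
    simp only [hhT]
    ring
  -- This is the tail estimate with `P = 1`, `j = 0` and a band of zero width: `12 * 2 π`.
  have hGint : ∫ x, G x ∂periodMeasure ≤ 24 * π := by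
    have e := H.norm_integral_mul_rieszTail_le h0 h1 K 0 le_rfl
      (one_mem_band (a := 0) (b := 0) le_rfl le_rfl)
    simp only [one_mul, ← hGT, integral_complex_ofReal, Complex.norm_real] at e
    have e2 : ∫ _, (1 : ℝ) ∂periodMeasure = 2 * π := by
      simp [Measure.real, Real.pi_pos.le]
    simp [e2] at e
    linarith [le_abs_self (∫ x, G x ∂periodMeasure)]
  have hup : ∫ x, (∑ a ∈ s, F a x) * G x ∂periodMeasure ≤ 24 * π * |B| := by
    calc _ ≤ ∫ x, |B| * G x ∂periodMeasure := by
          refine integral_mono_ae (integrable_period (by fun_prop)) (integrable_period (by fun_prop))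
            ?_
          filter_upwards [hB] with x hx
          exact mul_le_mul_of_nonneg_right (hx.trans (le_abs_self B)) (hG0 x)
      _ = |B| * ∫ x, G x ∂periodMeasure := integral_const_mul _ _
      _ ≤ |B| * (24 * π) := by gcongr
      _ = _ := by ring
  have hlow : ∀ a ∈ s, t * ∑ i ∈ Finset.range K, ∫ x, F a x * h i x ∂periodMeasure
      - 24 * t ^ 2 * ∫ x, |p a x| ∂periodMeasure ≤ ∫ x, F a x * G x ∂periodMeasure := by
    intro a ha
    -- `G` is split by order: constant (killed by mean zero), linear (the main term), and `R`, the
    -- tail of order at least 2.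
    have e1 : ∫ x, F a x * G x ∂periodMeasure = ∫ x, F a x ∂periodMeasure
        + t * ∑ i ∈ Finset.range K, ∫ x, F a x * h i x ∂periodMeasure
        + ∫ x, F a x * R x ∂periodMeasure := by
      have hFa := hFc a
      rw [Finset.mul_sum]
      simp only [← integral_const_mul]
      rw [← integral_finsetSum _ fun i _ => integrable_period (by have := hhc i; fun_prop)]
      have i1 : Integrable (F a) periodMeasure := integrable_period hFa
      have i2 : Integrable (fun x => ∑ i ∈ Finset.range K, t * (F a x * h i x)) periodMeasure :=
        integrable_period (by fun_prop)
      have i3 : Integrable (fun x => F a x * R x) periodMeasure := integrable_period (by fun_prop)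
      rw [← integral_add i1 i2]
      refine Eq.trans ?_ (integral_add (i1.add i2) i3)
      congr 1; funext x
      have : ∑ i ∈ Finset.range K, t * (F a x * h i x)
          = F a x * ∑ i ∈ Finset.range K, t * h i x := by
        rw [Finset.mul_sum]; exact Finset.sum_congr rfl fun i _ => by ring
      have hRx : R x = G x - 1 - ∑ i ∈ Finset.range K, t * h i x := rfl
      rw [this, hRx]; ring
    have e2 : ∫ x, F a x ∂periodMeasure = 0 :=
      integral_mul_trigMode_eq_zero (hp a) _ (hn a ha)
    have e3 := H.norm_integral_mul_trigMode_mul_rieszTail_le h0 h1 hd (hp a) (σ a) (n a) K 2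
    have e4 : ∀ x, ((p a x * trigMode (σ a) (n a) x : ℝ) : ℂ) * rieszTail t (v + w) K 2 x
        = ((F a x * R x : ℝ) : ℂ) := fun x => by rw [← hRT, ← Complex.ofReal_mul]
    simp only [e4, integral_complex_ofReal, Complex.norm_real, Real.norm_eq_abs] at e3
    rw [e1, e2]
    linarith [neg_le_of_abs_le e3]
  have hsum := Finset.sum_le_sum hlow
  rw [Finset.sum_sub_distrib, ← Finset.mul_sum, ← Finset.mul_sum, Finset.sum_comm] at hsum
  simp only [Finset.sum_mul] at hup
  rw [integral_finsetSum _ fun a _ => integrable_period (by have := hFc a; fun_prop)] at hup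
  exact hsum.trans hup

theorem sum_range_mul_eq (f : ℕ → ℝ) (s K : ℕ) :
    ∑ k ∈ Finset.range (s * K), f k
      = ∑ r ∈ Finset.range s, ∑ i ∈ Finset.range K, f (r + s * i) := by
  induction K with
  | zero => simp
  | succ K ih =>
    simp only [Finset.sum_range_succ]
    rw [mul_add, mul_one, Finset.sum_range_add, ih, Finset.sum_add_distrib]
    congr 1
    exact Finset.sum_congr rfl fun r _ => by rw [add_comm]

/-- The Sidon-type inequality, with the constant expressed through the number `s` of classes and
the norm of the de la Vallée-Poussin kernel. -/
theorem sum_integral_abs_le {N : ℕ → ℕ} {d M W s K : ℕ} (hM : 1 ≤ M) (hdM : d + M = W + 1)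
    (hs : 1 ≤ s) (hWN : W ≤ N 0) (hdW : d + W < 2 * N 0)
    (hgap : ∀ i j, i < j → N i + d + W < N j) (hlac : ∀ i, 7 * N i ≤ N (i + s))
    {p : ℕ → Bool → ℝ → ℝ} (hp : ∀ k τ, (fun x => (p k τ x : ℂ)) ∈ band (-d) d) {B : ℝ}
    (hB : ∀ᵐ x ∂periodMeasure, ∑ a ∈ Finset.range (s * K) ×ˢ (Finset.univ : Finset Bool),
      p a.1 a.2 x * trigMode a.2 (N a.1) x ≤ B) :
    ∑ a ∈ Finset.range (s * K) ×ˢ (Finset.univ : Finset Bool), ∫ x, |p a.1 a.2 x| ∂periodMeasure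
      ≤ 4096 * s ^ 2 * (26 * (1 + log ((d + M) / M))) ^ 2 * |B| := by
  set X := Finset.range (s * K) ×ˢ (Finset.univ : Finset Bool) with hX
  set S := ∑ a ∈ X, ∫ x, |p a.1 a.2 x| ∂periodMeasure with hS
  set L : ℝ := 26 * (1 + log ((d + M) / M)) with hL
  have hM' : (0 : ℝ) < M := by positivity
  have hs' : (1 : ℝ) ≤ s := by exact_mod_cast hs
  have hL1 : 1 ≤ L := by
    have : 0 ≤ log ((d + M : ℝ) / M) := by
      apply Real.log_nonneg
      rw [le_div_iff₀ hM']
      linarith [(Nat.cast_nonneg d : (0:ℝ) ≤ d)]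
    linarith
  have hmono : ∀ k, N 0 ≤ N k := fun k => by
    rcases Nat.eq_zero_or_pos k with h | h
    · rw [h]
    · have := hgap 0 k h; omega
  have hSnn : 0 ≤ S := Finset.sum_nonneg fun a _ => integral_nonneg fun x => abs_nonneg _
  -- Two pigeonhole choices: cosine or sine, then a residue class modulo `s`, retaining at least `S
  -- / (2 s)`.
  obtain ⟨τ, hτ⟩ : ∃ τ : Bool, S / 2 ≤ ∑ k ∈ Finset.range (s * K),
      ∫ x, |p k τ x| ∂periodMeasure := by
    have e : S = ∑ k ∈ Finset.range (s * K), ∫ x, |p k true x| ∂periodMeasure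
        + ∑ k ∈ Finset.range (s * K), ∫ x, |p k false x| ∂periodMeasure := by
      rw [hS, hX, Finset.sum_product, ← Finset.sum_add_distrib]
      exact Finset.sum_congr rfl fun k _ => by simp
    by_contra! hcon
    have h1 := hcon true
    have h2 := hcon false
    linarith
  obtain ⟨r, hr, hrS⟩ : ∃ r ∈ Finset.range s, S / 2 / s ≤ ∑ i ∈ Finset.range K,
      ∫ x, |p (r + s * i) τ x| ∂periodMeasure := by
    rw [sum_range_mul_eq] at hτ
    apply Finset.exists_le_of_sum_le (Finset.nonempty_range_iff.2 (by omega))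
    rw [Finset.sum_const, Finset.card_range, nsmul_eq_mul, mul_div_cancel₀ _ (by positivity)]
    exact hτ
  have hr := Finset.mem_range.1 hr
  choose u hu hu1 hup using fun i => exists_band_norming hM hdM.le (hp (r + s * i) τ)
  -- Frequency gaps remove every other index, and double-angle formulas remove the opposite mode at
  -- the same index. The surviving term is `1/2 * 2 π / L` times the `L¹` norm.
  have hdiag : ∀ i ∈ Finset.range K, ∑ a ∈ X, ∫ x, p a.1 a.2 x * trigMode a.2 (N a.1) x
      * (u i x * trigMode τ (N (r + s * i)) x) ∂periodMeasure
      = π / L * ∫ x, |p (r + s * i) τ x| ∂periodMeasure := by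
    intro i hi
    have hi := Finset.mem_range.1 hi
    have hmem : (r + s * i, τ) ∈ X := by
      rw [hX, Finset.mem_product, Finset.mem_range]
      refine ⟨?_, Finset.mem_univ _⟩
      calc r + s * i < s + s * i := by omega
        _ = s * (i + 1) := by ring
        _ ≤ s * K := Nat.mul_le_mul_left _ hi
    rw [Finset.sum_eq_single_of_mem _ hmem]
    · have := hmono (r + s * i)
      rw [integral_mul_trigMode_mul_trigMode_self (hp _ _) (hu i) _ _ (by dsimp only; omega), if_pos rfl]
      have h1 := hup i
      field_simp
      linarith
    · rintro ⟨k, σ⟩ - hne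
      have h1 := hmono k
      have h2 := hmono (r + s * i)
      rcases lt_trichotomy k (r + s * i) with h | h | h
      · have := hgap _ _ h
        exact integral_mul_trigMode_mul_trigMode_of_ne (hp _ _) (hu i) _ _ (by dsimp only; omega)
          (Or.inl this)
      · subst h
        have hσ : σ ≠ τ := fun h => hne (by rw [h])
        rw [integral_mul_trigMode_mul_trigMode_self (hp _ _) (hu i) _ _ (by dsimp only; omega),
          if_neg hσ]
      · have := hgap _ _ h
        exact integral_mul_trigMode_mul_trigMode_of_ne (hp _ _) (hu i) _ _ (by dsimp only; omega)
          (Or.inr this)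
  have hsL : 1 ≤ s * L := one_le_mul_of_one_le_of_one_le hs' hL1
  -- The value `t = 1 / (32 s L)` maximises `3 t / (2 s L) - 24 t²`, the net gain per unit of `S`
  -- once `π` is replaced by 3.
  have ht0 : 0 ≤ 1 / (32 * (s * L)) := by positivity
  have ht1 : 1 / (32 * (s * L)) ≤ 1 := by
    rw [div_le_one (by positivity)]; linarith
  have hd : d < N 0 := by omega
  have key := riesz_product_test X (N := fun i => N (r + s * i)) (by omega : d ≤ W)
    (by have := hmono (r + s * 0); omega) (hWN.trans (hmono _))
    (fun i => by have := hlac (r + s * i); rwa [add_assoc, ← Nat.mul_succ] at this)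
    hu hu1 τ (p := fun a => p a.1 a.2) (fun a => N a.1) (fun a => a.2) (fun a => hp _ _)
    (fun a _ => hd.trans_le (hmono _)) hB K ht0 ht1
  rw [Finset.sum_congr rfl hdiag, ← Finset.mul_sum] at key
  have h1 : 3 / L * (S / 2 / s) ≤ π / L * ∑ i ∈ Finset.range K,
      ∫ x, |p (r + s * i) τ x| ∂periodMeasure := by
    gcongr
    exact Real.pi_gt_three.le
  have h2 := mul_le_mul_of_nonneg_left h1 ht0
  have h3 : 24 * π * |B| ≤ 96 * |B| := by
    have := Real.pi_lt_four
    gcongr; linarith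
  have h4 : 1 / (32 * (s * L)) * (3 / L * (S / 2 / s)) - 24 * (1 / (32 * (s * L))) ^ 2 * S
      = 3 / 128 * (S / (s * L) ^ 2) := by
    field_simp; ring
  have h5 : S / (s * L) ^ 2 ≤ 4096 * |B| := by linarith
  rw [div_le_iff₀ (by positivity)] at h5
  calc S ≤ _ := h5
    _ = _ := by ring

/-! ### Norm conversions, lacunarity and the final inequality -/

theorem normLp_one_eq {p : ℝ → ℝ} (hp : Continuous p) :
    normLp 1 p = ENNReal.ofReal (∫ x, |p x| ∂periodMeasure) := by
  rw [normLp, eLpNorm_one_eq_lintegral_enorm,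
    ← ofReal_integral_norm_eq_lintegral_enorm (integrable_period hp)]
  simp only [Real.norm_eq_abs]

theorem ae_abs_le_toReal_normLp_top {f : ℝ → ℝ} (hf : normLp ∞ f ≠ ∞) :
    ∀ᵐ x ∂periodMeasure, |f x| ≤ (normLp ∞ f).toReal := by
  have h := ae_le_eLpNormEssSup (f := f) (μ := periodMeasure)
  rw [← eLpNorm_exponent_top] at h
  filter_upwards [h] with x hx
  have := ENNReal.toReal_mono hf hx
  simpa using this

theorem seven_le_pow_ceil {lam : ℝ} (h : 1 < lam) :
    7 ≤ lam ^ ⌈Real.log 7 / Real.log lam⌉.toNat := by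
  have hl : 0 < log lam := Real.log_pos h
  have h7 : 0 < log 7 := Real.log_pos (by norm_num)
  have hc : (0 : ℤ) ≤ ⌈log 7 / log lam⌉ := Int.ceil_nonneg (by positivity)
  have h1 : log 7 / log lam ≤ (⌈log 7 / log lam⌉.toNat : ℝ) := by
    have := Int.le_ceil (log 7 / log lam)
    have e : ((⌈log 7 / log lam⌉.toNat : ℤ) : ℝ) = ⌈log 7 / log lam⌉ := by rw [Int.toNat_of_nonneg hc]
    rw [← e] at this
    exact_mod_cast this
  rw [← Real.log_le_log_iff (by norm_num) (by positivity), Real.log_pow]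
  rwa [div_le_iff₀ hl] at h1

theorem lacunary_pow_mul_le {lam : ℝ} (hlam : 1 < lam) {N : ℕ → ℕ}
    (hN : ∀ k, lam * N k ≤ N (k + 1)) (k s : ℕ) : lam ^ s * N k ≤ N (k + s) := by
  induction s with
  | zero => simp
  | succ s ih =>
    calc lam ^ (s + 1) * N k = lam * (lam ^ s * N k) := by ring
      _ ≤ lam * N (k + s) := by gcongr
      _ ≤ _ := hN _

theorem corollaryS1 :
    ∃ c : ℝ, 0 < c ∧
      ∀ (ε lam : ℝ) (n : ℕ → ℕ) (l m : ℕ) (p q : ℕ → ℝ → ℝ),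
        0 < ε → ε < 1 → 1 < lam →
        (∀ k : ℕ, 1 ≤ k → 0 < n k) →
        (∀ k : ℕ, 1 ≤ k → lam ≤ (n (k + 1) : ℝ) / (n k : ℝ)) →
        1 ≤ l → l + 2 ≤ m →
        (∀ k ∈ Finset.Icc l m,
          p k ∈ TrigPoly (min ((lam - 1) / (2 * (1 + ε))) (1 / (1 + ε)) * (n l : ℝ)) ∧
          q k ∈ TrigPoly (min ((lam - 1) / (2 * (1 + ε))) (1 / (1 + ε)) * (n l : ℝ))) →
        ENNReal.ofReal
            (c / (((⌈Real.log 7 / Real.log lam⌉ : ℤ) : ℝ) ^ 2 * Real.log (1 + 1 / ε) ^ 2)) *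
            ∑ k ∈ Finset.Icc l m, (normLp 1 (p k) + normLp 1 (q k)) ≤
          normLp ∞ (fun x : ℝ => ∑ k ∈ Finset.Icc l m,
            (p k x * Real.cos ((n k : ℝ) * x) + q k x * Real.sin ((n k : ℝ) * x))) := by
  refine ⟨1 / (4096 * 78 ^ 2), by norm_num, ?_⟩
  intro ε lam n l m p q hε hε1 hlam hn hrat hl hlm hpq
  set f : ℝ → ℝ := fun x : ℝ => ∑ k ∈ Finset.Icc l m,
    (p k x * Real.cos ((n k : ℝ) * x) + q k x * Real.sin ((n k : ℝ) * x)) with hf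
  by_cases hfin : normLp ∞ f = ∞
  · rw [hfin]; exact le_top
  set D : ℝ := min ((lam - 1) / (2 * (1 + ε))) (1 / (1 + ε)) * (n l : ℝ) with hD
  set N : ℕ → ℕ := fun k => n (l + k) with hNdef
  have hNpos : ∀ k, 0 < N k := fun k => hn _ (by omega)
  have hN0 : (0 : ℝ) < N 0 := by exact_mod_cast hNpos 0
  have hNlam : ∀ k, lam * N k ≤ N (k + 1) := fun k =>
    (le_div_iff₀ (by exact_mod_cast hNpos k)).1 (hrat (l + k) (by omega))
  have hDpos : 0 < D := by
    have : 0 < lam - 1 := by linarith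
    exact mul_pos (lt_min (by positivity) (by positivity)) hN0
  -- The first entry of the minimum separates the blocks, since `d + W < 2 (1 + ε) D`; the second,
  -- used next, keeps `W ≤ N 0`.
  have hD1 : 2 * ((1 + ε) * D) ≤ (lam - 1) * N 0 := by
    have h1 : D ≤ (lam - 1) / (2 * (1 + ε)) * N 0 :=
      mul_le_mul_of_nonneg_right (min_le_left _ _) hN0.le
    calc 2 * ((1 + ε) * D) ≤ 2 * ((1 + ε) * ((lam - 1) / (2 * (1 + ε)) * N 0)) := by gcongr
      _ = _ := by field_simp
  have hD2 : (1 + ε) * D ≤ N 0 := by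
    have h1 : D ≤ 1 / (1 + ε) * N 0 := mul_le_mul_of_nonneg_right (min_le_right _ _) hN0.le
    calc (1 + ε) * D ≤ (1 + ε) * (1 / (1 + ε) * N 0) := by gcongr
      _ = _ := by field_simp
  set d := ⌊D⌋₊ with hd
  set W := ⌊(1 + ε) * D⌋₊ with hW
  have hdD : (d : ℝ) ≤ D := Nat.floor_le hDpos.le
  have hWD : (W : ℝ) ≤ (1 + ε) * D := Nat.floor_le (by positivity)
  have hDW : (1 + ε) * D < W + 1 := Nat.lt_floor_add_one _
  have hDε : D < (1 + ε) * D := by nlinarith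
  have hdW : d ≤ W := Nat.floor_le_floor hDε.le
  -- `M` is the largest averaging length allowed by degree `W`. The extra 1 offsets the floor and
  -- gives `M ≥ ε D`, hence `(d + M) / M ≤ 1 + 1 / ε`.
  obtain ⟨M, hM⟩ : ∃ M, d + M = W + 1 := ⟨W + 1 - d, by omega⟩
  have hMε : ε * D ≤ M := by
    have : (d : ℝ) + M = W + 1 := by exact_mod_cast hM
    linarith
  have hM1 : 1 ≤ M := by omega
  have hM0 : (0 : ℝ) < M := by positivity
  set c := ⌈Real.log 7 / Real.log lam⌉ with hc
  have hcpos : 0 < c := by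
    have := Real.log_pos hlam
    have : 0 < Real.log 7 := Real.log_pos (by norm_num)
    exact Int.ceil_pos.2 (by positivity)
  set s := c.toNat with hs
  have hsc : (s : ℝ) = c := by
    have : (s : ℤ) = c := Int.toNat_of_nonneg hcpos.le
    exact_mod_cast this
  have hs1 : 1 ≤ s := by omega
  have hlac : ∀ i, 7 * N i ≤ N (i + s) := fun i => by
    have h1 := lacunary_pow_mul_le hlam hNlam i s
    have h2 : (7 : ℝ) ≤ lam ^ s := seven_le_pow_ceil hlam
    have h3 : (7 : ℝ) * N i ≤ N (i + s) :=
      (mul_le_mul_of_nonneg_right h2 (Nat.cast_nonneg _)).trans h1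
    exact_mod_cast h3
  have hmono : Monotone N := monotone_nat_of_le_succ fun k => by
    have h1 := hNlam k
    have h2 : (N k : ℝ) ≤ N (k + 1) := by
      nlinarith [(Nat.cast_nonneg (N k) : (0 : ℝ) ≤ N k)]
    exact_mod_cast h2
  have hgap : ∀ i j, i < j → N i + d + W < N j := fun i j hij => by
    have h1 := hNlam i
    have h2 : (N 0 : ℝ) ≤ N i := by exact_mod_cast hmono (Nat.zero_le i)
    have h3 : (N (i + 1) : ℝ) ≤ N j := by exact_mod_cast hmono hij
    have h4 : (lam - 1) * N 0 ≤ (lam - 1) * N i :=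
      mul_le_mul_of_nonneg_left h2 (by linarith)
    have : (N i : ℝ) + d + W < N j := by linarith
    exact_mod_cast this
  set K := m + 1 - l with hK
  -- Padding by zero up to index `s * K` gives all residue classes the same length `K`.
  let P : ℕ → Bool → ℝ → ℝ := fun k τ =>
    if k < K then (if τ then p (l + k) else q (l + k)) else 0
  have hPband : ∀ k τ, (fun x => (P k τ x : ℂ)) ∈ band (-d) d := by
    intro k τ
    by_cases hk : k < K
    · have h1 := hpq (l + k) (Finset.mem_Icc.2 ⟨by omega, by omega⟩)
      cases τ
      · simpa [P, hk] using ofReal_mem_band_of_mem_trigPoly h1.2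
      · simpa [P, hk] using ofReal_mem_band_of_mem_trigPoly h1.1
    · simp only [P, hk, if_false, Pi.zero_apply, Complex.ofReal_zero]
      exact zero_mem (band (-d) d)
  have hreindex : ∀ {A : Type} [AddCommMonoid A] (φ : ℕ → Bool → (ℝ → ℝ) → A),
      (∀ k τ, φ k τ 0 = 0) →
      ∑ a ∈ Finset.range (s * K) ×ˢ (Finset.univ : Finset Bool), φ a.1 a.2 (P a.1 a.2)
        = ∑ k ∈ Finset.Icc l m, (φ (k - l) true (p k) + φ (k - l) false (q k)) := by
    intro A _ φ hφ
    have hKs : K ≤ s * K := Nat.le_mul_of_pos_left _ hs1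
    rw [Finset.sum_product, ← Finset.sum_subset (Finset.range_subset_range.2 hKs),
      show Finset.Icc l m = Finset.Ico l (m + 1) from rfl, Finset.sum_Ico_eq_sum_range]
    · refine Finset.sum_congr rfl fun k hk => ?_
      have hk : k < K := Finset.mem_range.1 hk
      simp [P, hk]
    · intro k _ hk
      have hk : ¬ k < K := fun h => hk (Finset.mem_range.2 h)
      simp [P, hk, hφ]
  have hBae : ∀ᵐ x ∂periodMeasure,
      ∑ a ∈ Finset.range (s * K) ×ˢ (Finset.univ : Finset Bool),
        P a.1 a.2 x * trigMode a.2 (N a.1) x ≤ (normLp ∞ f).toReal := by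
    filter_upwards [ae_abs_le_toReal_normLp_top hfin] with x hx
    refine le_trans (le_of_eq ?_) ((le_abs_self _).trans hx)
    rw [hreindex (fun k τ g => g x * trigMode τ (N k) x) (by simp)]
    refine Finset.sum_congr rfl fun k hk => ?_
    have hk := (Finset.mem_Icc.1 hk).1
    simp [trigMode, N, Nat.add_sub_cancel' hk]
  have main := sum_integral_abs_le hM1 hM hs1 (K := K)
    (by exact_mod_cast hWD.trans hD2)
    (by have h1 : (d : ℝ) + W < 2 * N 0 := by linarith
        exact_mod_cast h1) hgap hlac hPband hBae
  rw [hreindex (fun _ _ g => ∫ x, |g x| ∂periodMeasure) (by simp)] at main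
  have hlogε : 1 / 2 ≤ Real.log (1 + 1 / ε) := by
    have h1 : (2 : ℝ) ≤ 1 + 1 / ε := by
      have : 1 ≤ 1 / ε := by rw [le_div_iff₀ hε]; linarith
      linarith
    have := Real.log_le_log (by norm_num) h1
    linarith [Real.log_two_gt_d9]
  have hlog : Real.log ((d + M) / M) ≤ Real.log (1 + 1 / ε) := by
    apply Real.log_le_log (by positivity)
    have : (d : ℝ) / M ≤ 1 / ε := by
      rw [div_le_div_iff₀ hM0 hε]
      nlinarith
    rw [add_div, div_self hM0.ne']
    linarith
  have hlog0 : 0 ≤ Real.log ((d + M : ℝ) / M) := by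
    apply Real.log_nonneg
    rw [le_div_iff₀ hM0]
    linarith [(Nat.cast_nonneg d : (0:ℝ) ≤ d)]
  have hsum : ∑ k ∈ Finset.Icc l m, (normLp 1 (p k) + normLp 1 (q k))
      = ENNReal.ofReal (∑ k ∈ Finset.Icc l m,
        (∫ x, |p k x| ∂periodMeasure + ∫ x, |q k x| ∂periodMeasure)) := by
    have hnn : ∀ g : ℝ → ℝ, 0 ≤ ∫ x, |g x| ∂periodMeasure :=
      fun g => integral_nonneg fun x => abs_nonneg _
    rw [ENNReal.ofReal_sum_of_nonneg fun k _ => add_nonneg (hnn _) (hnn _)]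
    refine Finset.sum_congr rfl fun k hk => ?_
    rw [ENNReal.ofReal_add (hnn _) (hnn _),
      normLp_one_eq (continuous_of_ofReal_mem_band (ofReal_mem_band_of_mem_trigPoly (hpq k hk).1)),
      normLp_one_eq (continuous_of_ofReal_mem_band (ofReal_mem_band_of_mem_trigPoly (hpq k hk).2))]
  have hcR : (0 : ℝ) < c := by exact_mod_cast hcpos
  have hlogpos : 0 < Real.log (1 + 1 / ε) := by linarith
  rw [hsum, ← ENNReal.ofReal_mul (by positivity)]
  refine ENNReal.ofReal_le_of_le_toReal ?_
  rw [hsc, abs_of_nonneg ENNReal.toReal_nonneg] at main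
  -- Since `ε < 1`, the logarithm is at least `1/2`, so `1 + log ≤ 3 log`; hence `78 = 3 * 26`.
  have h1 : 26 * (1 + Real.log ((d + M : ℝ) / M)) ≤ 78 * Real.log (1 + 1 / ε) := by linarith
  have h2 : ∑ k ∈ Finset.Icc l m, (∫ x, |p k x| ∂periodMeasure + ∫ x, |q k x| ∂periodMeasure)
      ≤ 4096 * c ^ 2 * (78 * Real.log (1 + 1 / ε)) ^ 2 * (normLp ∞ f).toReal :=
    main.trans (by gcongr)
  calc _ ≤ 1 / (4096 * 78 ^ 2) / ((c : ℝ) ^ 2 * Real.log (1 + 1 / ε) ^ 2)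
        * (4096 * c ^ 2 * (78 * Real.log (1 + 1 / ε)) ^ 2 * (normLp ∞ f).toReal) := by gcongr
    _ = _ := by
      generalize Real.log (1 + 1 / ε) = L at hlogpos
      field_simp
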